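/- Let $\mathbb K$ be a field. Let $T$ be an oriented tangle diagram in the disk (a generic immersion, with over/under information at each crossing, of finitely many arcs with endpoints on the boundary circle and finitely many circles), with $n_+$ right-handed and $n_-$ left-handed crossings. For $s\in\{0,1\}^{n_++n_-}$ let $T_s$ be the smoothing of $T$ given by $s$, where the $0$-smoothing of a right-handed crossing and the $1$-smoothing of a left-handed crossing are the orientation-respecting ones. Let $V=\langle v_+,v_-\rangle$ and $W=\langle w\rangle$ be graded $\mathbb K$-vector spaces with $\deg v_\pm=\pm1$, $\deg w=-1$, and let $\mathcal G(T_s)$ be the tensor product of a copy of $V$ for every circle of $T_s$ and a copy of $W$ for every arc of $T_s$. The Khovanov complex of $T$ is $\bigoplus_s\mathcal G(T_s)$, with differential the sum, over the edges of the cube with the usual signs, of the saddle maps $$v_+\otimes v_+\mapsto v_+,\quad v_+\otimes v_-,\ v_-\otimes v_+\mapsto v_-,\quad v_-\otimes v_-\mapsto 0,\quad v_+\otimes w\mapsto w,\quad v_-\otimes w\mapsto 0$$ for merging two circles, or a circle and an arc, $$v_+\mapsto v_+\otimes v_-+v_-\otimes v_+,\quad v_-\mapsto v_-\otimes v_-,\quad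 w\mapsto v_-\otimes w$$ for splitting a circle into two circles, or an arc into a circle and an arc, and zero for a saddle from two arcs to two arcs. An element $x\in\mathcal G(T_s)$ of degree $\theta(x)$ has homological degree $k=|s|-n_-$ and quantum degree $k+n_+-n_-+\theta(x)$, where $|s|$ is the number of $1$'s in $s$. Let $H^{k,q}(T)$ be the cohomology in homological degree $k$ and quantum degree $q$. **Theorem.** Let $T'$ be an oriented tangle diagram in the disk obtained from an oriented tangle diagram $T$ by adding an oriented arc, with two new endpoints on the boundary circle, that has exactly one crossing, this being a crossing with $T$ at which the arc passes either over or under $T$. Let $k,q\in\mathbb Z$. - If the added crossing is right-handed, then $H^{k,q}(T')\cong H^{k,q}(T)\oplus H^{k-1,q-1}(T)$. - If the added crossing is left-handed, then $H^{k,q}(T')\cong H^{k+1,q+3}(T)\oplus H^{k,q+2}(T)$. -/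

import Mathlib

/-! Oriented tangle diagrams in the disk, as planar combinatorial maps, and their Khovanov
homology over a field. -/

/-- Half-edges of a tangle diagram with `n` crossings and `m` endpoints on the boundary circle.
`Sum.inl (c, i)` is the half-edge leaving the crossing `c` at its slot `i`. The four slots are
numbered counterclockwise, slot `0` being the incoming end of the understrand; so the understrand
runs from slot `0` to slot `2` and the overstrand occupies the slots `1` and `3`.
`Sum.inr j` is the half-edge that starts at the `j`-th endpoint; the endpoints are numbered
counterclockwise along the boundary circle. -/
abbrev HalfEdge (n m : ℕ) : Type := (Fin n × Fin 4) ⊕ Fin m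

namespace HalfEdge

/-- Counterclockwise rotation about the vertices. The outside of the disk is collapsed to a single
vertex of the sphere, incident to all endpoints; the counterclockwise order around that vertex is
the clockwise order along the boundary circle of the disk. -/
def rotation (n m : ℕ) : HalfEdge n m → HalfEdge n m
  | Sum.inl (c, i) => Sum.inl (c, i + 1)
  | Sum.inr j => Sum.inr ((finRotate m).symm j)

/-- `h` is directed away from its vertex. For `positive c` (a right-handed crossing) the overstrand
runs from slot `3` to slot `1`, otherwise from slot `1` to slot `3`. An endpoint is `inward` if the
strand that is attached there is directed from the boundary circle into the disk. -/
def outgoing {n m : ℕ} (positive : Fin n → Bool) (inward : Fin m → Bool) : HalfEdge n m → Bool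
  | Sum.inl (c, i) => ![false, positive c, true, !positive c] i
  | Sum.inr j => inward j

end HalfEdge

/-- The number of orbits of the self-map `f`, i.e. of cycles if `f` is a permutation. -/
noncomputable def orbitCount {X : Type} (f : X → X) : ℕ :=
  Nat.card (Quot fun x y => y = f x)

/-- The number of classes of the equivalence relation generated by `x ∼ f x` and `x ∼ g x`. -/
noncomputable def jointOrbitCount {X : Type} (f g : X → X) : ℕ :=
  Nat.card (Quot fun x y => y = f x ∨ y = g x)

/-- An oriented tangle diagram in the disk, up to planar isotopy: a four-valent graph with crossing
information, given by the matching `edge` of its half-edges. Components without crossings that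
are closed are recorded by their number `numLoops`. -/
structure TangleDiagram where
  /-- number of crossings -/
  numCrossings : ℕ
  /-- number of endpoints on the boundary circle -/
  numEnds : ℕ
  /-- number of crossingless closed components -/
  numLoops : ℕ
  /-- the two halves of an edge are exchanged -/
  edge : HalfEdge numCrossings numEnds → HalfEdge numCrossings numEnds
  /-- `true` for right-handed crossings, `false` for left-handed ones -/
  positive : Fin numCrossings → Bool
  /-- orientation at the endpoints -/
  inward : Fin numEnds → Bool
  edge_edge : ∀ h, edge (edge h) = h
  edge_ne : ∀ h, edge h ≠ h
  /-- each edge is directed away from exactly one of its two ends -/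
  outgoing_edge : ∀ h,
    HalfEdge.outgoing positive inward (edge h) = !HalfEdge.outgoing positive inward h
  /-- Euler's formula `V + F = E + 2 C`: every connected component of the map has genus zero.
  (The faces are the orbits of rotation after edge flip.) -/
  planar :
    orbitCount (HalfEdge.rotation numCrossings numEnds) +
        orbitCount (fun h => HalfEdge.rotation numCrossings numEnds (edge h)) =
      orbitCount edge + 2 * jointOrbitCount (HalfEdge.rotation numCrossings numEnds) edge

/-- `ArcAddition T T'` exhibits `T'` as obtained from `T` by adding an arc that meets `T` in
exactly one crossing. The arc runs between two new endpoints `startPt`, `endPt`, through the opposite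
slots `slot`, `slot + 2` of the new crossing (so it passes under `T` if `slot` is `0` or `2`, over
`T` if it is `1` or `3`). The edge of `T` that is crossed is cut in two, its two halves being
attached to the slots `slot + 1` and `slot + 3`; everything else is as in `T`. The numberings of
crossings are arbitrary, endpoints keep their cyclic order. -/
structure ArcAddition (T T' : TangleDiagram) where
  /-- the new crossing -/
  crossing : Fin T'.numCrossings
  /-- the slot of the new crossing where the arc enters -/
  slot : Fin 4
  /-- the endpoint where the arc begins -/
  startPt : Fin T'.numEnds
  /-- the endpoint where the arc ends -/
  endPt : Fin T'.numEnds
  /-- the crossings of `T`, as crossings of `T'` -/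
  crossingMap : Fin T.numCrossings ↪ Fin T'.numCrossings
  /-- the endpoints of `T`, as endpoints of `T'` -/
  endMap : Fin T.numEnds ↪ Fin T'.numEnds
  edge_startPt : T'.edge (Sum.inr startPt) = Sum.inl (crossing, slot)
  edge_endPt : T'.edge (Sum.inr endPt) = Sum.inl (crossing, slot + 2)
  range_crossingMap : Set.range crossingMap = {crossing}ᶜ
  range_endMap : Set.range endMap = {startPt, endPt}ᶜ
  positive_crossingMap : ∀ c, T'.positive (crossingMap c) = T.positive c
  inward_endMap : ∀ j, T'.inward (endMap j) = T.inward j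
  sbtw_endMap : ∀ a b c, sbtw a b c → sbtw (endMap a) (endMap b) (endMap c)
  numLoops_eq : T'.numLoops = T.numLoops
  /-- Two half-edges that form an edge of `T` either form an edge of `T'`, or are joined in `T'` to
  the two free slots of the new crossing. -/
  edge_map : ∀ h,
    let ι : HalfEdge T.numCrossings T.numEnds → HalfEdge T'.numCrossings T'.numEnds :=
      Sum.map (Prod.map crossingMap id) endMap
    T'.edge (ι h) = ι (T.edge h) ∨
    (T'.edge (ι h) = Sum.inl (crossing, slot + 1) ∧
      T'.edge (ι (T.edge h)) = Sum.inl (crossing, slot + 3)) ∨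
    (T'.edge (ι h) = Sum.inl (crossing, slot + 3) ∧
      T'.edge (ι (T.edge h)) = Sum.inl (crossing, slot + 1))

/-- The generators of the graded vector spaces `V = ⟨v₊, v₋⟩` (attached to a circle) and `W = ⟨w⟩`
(attached to an arc). -/
inductive TangleGen : Type
  | vPlus | vMinus | w
  deriving DecidableEq

namespace TangleGen

instance : Fintype TangleGen := ⟨{vPlus, vMinus, w}, fun x => by cases x <;> simp⟩

/-- Quantum degree of a generator. -/
def deg : TangleGen → ℤ
  | vPlus => 1
  | vMinus => -1
  | w => -1

/-- `mulCoeff x y z` is the coefficient of `z` in the product of `x` and `y`, for the maps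
`V ⊗ V → V`, `V ⊗ W → W`, `W ⊗ V → W`:
`v₊v₊ = v₊`, `v₊v₋ = v₋v₊ = v₋`, `v₋v₋ = 0`, `v₊w = wv₊ = w`, `v₋w = wv₋ = 0`. -/
def mulCoeff : TangleGen → TangleGen → TangleGen → ℤ
  | vPlus, vPlus, vPlus => 1
  | vPlus, vMinus, vMinus => 1
  | vMinus, vPlus, vMinus => 1
  | vPlus, w, w => 1
  | w, vPlus, w => 1
  | _, _, _ => 0

/-- `comulCoeff x y z` is the coefficient of `y ⊗ z` in the coproduct of `x`, for the maps
`V → V ⊗ V`, `W → V ⊗ W`, `W → W ⊗ V`: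
`v₊ ↦ v₊ ⊗ v₋ + v₋ ⊗ v₊`, `v₋ ↦ v₋ ⊗ v₋`, `w ↦ v₋ ⊗ w` resp. `w ↦ w ⊗ v₋`. -/
def comulCoeff : TangleGen → TangleGen → TangleGen → ℤ
  | vPlus, vPlus, vMinus => 1
  | vPlus, vMinus, vPlus => 1
  | vMinus, vMinus, vMinus => 1
  | w, vMinus, w => 1
  | w, w, vMinus => 1
  | _, _, _ => 0

end TangleGen

namespace TangleDiagram

variable (T : TangleDiagram)

/-- Half-edges of the diagram. -/
abbrev Half : Type := HalfEdge T.numCrossings T.numEnds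

/-- Number of right-handed crossings. -/
def nPlus : ℕ := (Finset.univ.filter fun c => T.positive c = true).card

/-- Number of left-handed crossings. -/
def nMinus : ℕ := (Finset.univ.filter fun c => T.positive c = false).card

/-- A vertex of the cube: a smoothing (`false` is the `0`-smoothing, `true` the `1`-smoothing) for
each crossing. -/
abbrev State : Type := Fin T.numCrossings → Bool

/-- The slot to which a slot is joined in a smoothing: the `0`-smoothing joins slots `0, 1` and slots
`2, 3` (for a right-handed crossing it is the smoothing that respects the orientation), the
`1`-smoothing joins slots `1, 2` and slots `3, 0`. -/
def partner : Bool → Fin 4 → Fin 4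
  | false => ![1, 0, 3, 2]
  | true => ![3, 2, 1, 0]

variable {T}

/-- Two half-edges that are adjacent on the smoothed diagram. -/
def Linked (s : T.State) (h h' : T.Half) : Prop :=
  h' = T.edge h ∨ ∃ c i, h = Sum.inl (c, i) ∧ h' = Sum.inl (c, partner (s c) i)

/-- The components of the smoothed diagram `T_s`. -/
abbrev Component (s : T.State) : Type := Quot (Linked s) ⊕ Fin T.numLoops

/-- The component of `T_s` through a half-edge. -/
def comp (s : T.State) (h : T.Half) : Component s := Sum.inl (Quot.mk _ h)

/-- A component is an arc if it has an endpoint on the boundary circle, and a circle otherwise. -/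
def IsArc {s : T.State} (x : Component s) : Prop := ∃ j, x = comp s (Sum.inr j)

noncomputable instance (s : T.State) : Fintype (Component s) := Fintype.ofFinite _

/-- The standard basis of the vector space attached to `T_s`, the tensor product of one copy of
`V` for each circle and one copy of `W` for each arc. -/
abbrev Labelling (s : T.State) : Type :=
  {l : Component s → TangleGen // ∀ x, l x = TangleGen.w ↔ IsArc x}

variable (T) in
/-- The standard basis of the direct sum of the vector spaces of all `T_s`. -/
abbrev Enhanced : Type := Σ s : T.State, Labelling s

/-- Height of a state: the number of `1`-smoothings. -/
def height (s : T.State) : ℕ := (Finset.univ.filter fun c => s c = true).card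

/-- Homological degree. -/
def hdeg (S : T.Enhanced) : ℤ := (height S.1 : ℤ) - T.nMinus

/-- Quantum degree. -/
noncomputable def qdeg (S : T.Enhanced) : ℤ :=
  hdeg S + T.nPlus - T.nMinus + ∑ x, (S.2.1 x).deg

/-- The matrix entry of the saddle map at the crossing `c`, from a basis vector of `T_s` (with
`s c = 0`) to a basis vector of `T_s'` (where `s'` is `s` with `s c` changed to `1`). The two strands
of `T_s` at `c` lie on the components of slots `0` and `2`, the two strands of `T_s'` on those of
slots `0` and `1`. Two components are merged by the product, one component is split by the
coproduct, and the saddle between two arcs and two arcs acts as zero; the labels of the components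
that do not meet `c` are kept. -/
noncomputable def saddleCoeff (c : Fin T.numCrossings) {s s' : T.State}
    (l : Labelling s) (l' : Labelling s') : ℤ :=
  let a := comp s (Sum.inl (c, 0))
  let b := comp s (Sum.inl (c, 2))
  let a' := comp s' (Sum.inl (c, 0))
  let b' := comp s' (Sum.inl (c, 1))
  open Classical in
  if (∀ h, comp s h ≠ a → comp s h ≠ b → l'.1 (comp s' h) = l.1 (comp s h)) ∧
      ∀ k : Fin T.numLoops, l'.1 (Sum.inr k) = l.1 (Sum.inr k) then
    if a ≠ b ∧ a' = b' then TangleGen.mulCoeff (l.1 a) (l.1 b) (l'.1 a')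
    else if a = b ∧ a' ≠ b' then TangleGen.comulCoeff (l.1 a) (l'.1 a') (l'.1 b')
    else 0
  else 0

/-- Sign of the edge of the cube that starts at `s` in the direction `c`. -/
def edgeSign (s : T.State) (c : Fin T.numCrossings) : ℤ :=
  (-1) ^ (Finset.univ.filter fun j => j < c ∧ s j = true).card

/-- Matrix entry of the differential of the Khovanov complex. -/
noncomputable def diffCoeff (S S' : T.Enhanced) : ℤ :=
  ∑ c, if S.1 c = false ∧ S'.1 = Function.update S.1 c true then
    edgeSign S.1 c * saddleCoeff c S.2 S'.2 else 0

variable (T) in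
/-- Basis of the part of the Khovanov complex of homological degree `k` and quantum degree `q`. -/
abbrev Basis (k q : ℤ) : Type := {S : T.Enhanced // hdeg S = k ∧ qdeg S = q}

noncomputable instance (k q : ℤ) : Fintype (T.Basis k q) := Fintype.ofFinite _

variable (K : Type*) [Field K]

variable (T) in
/-- The differential of the Khovanov complex in quantum degree `q`, from homological degree `k` to
homological degree `k'` (nonzero only for `k' = k + 1`). A vector is a family of coordinates with
respect to the standard basis. -/
noncomputable def diff (k k' q : ℤ) : (T.Basis k q → K) →ₗ[K] (T.Basis k' q → K) :=
  Matrix.mulVecLin (Matrix.of fun S' S => (diffCoeff S.1 S'.1 : K))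

variable (T) in
/-- Khovanov homology `H^{k,q}(T)` over the field `K`: the kernel of the differential out of
bidegree `(k, q)` modulo the image of the differential into it (for a planar diagram the composite
of the two is zero). -/
abbrev Kh (k q : ℤ) : Type _ :=
  LinearMap.ker (T.diff K k (k + 1) q) ⧸
    (LinearMap.range (T.diff K (k - 1) k q)).comap (LinearMap.ker (T.diff K k (k + 1) q)).subtype

end TangleDiagram

/-! A smoothing of the new crossing cuts the added arc into two parts, each of which is attached to
one side of the edge of `T` that is crossed. The component of `T_s` through that edge is always an
arc: a circle would be a closed curve crossing the added arc exactly once, which the Jordan curve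
theorem forbids (`isArc_comp_cut`). So the smoothing of `T'` is `T_s` with this one arc replaced by
two arcs. Arcs carry the one-dimensional space `W`, hence both smoothings have the same labellings,
up to a degree shift by -1 (`pullback_bijective`, `sum_deg_pullback`).

The saddle at the new crossing leads from two arcs to two arcs and vanishes
(`saddleCoeff_crossing`); all other saddles have the same coefficients as in `T`
(`saddleCoeff_pullback`). The complex of `T'` is therefore the direct sum of two shifted copies of
the complex of `T`, one for each smoothing of the new crossing. The signs of the cubes, which depend
on the numbering of the crossings, are reconciled by a diagonal change of basis (`sgn_update`).

The topology has to be extracted from Euler's formula. A dimension count over `ZMod 2` shows that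
every cycle bounds (`exists_potential`), so a closed curve two-colours the faces. If it avoids the
boundary circle, all faces there have one colour, whereas following the added arc from end to end
would change the colour once (`no_closed_curve`). The two parts of the added arc lie on different
components because a component, being a dihedral orbit, has at most two endpoints
(`end_eq_of_comp_eq`). -/

section

open Function

/-! ### Cycles and boundaries modulo 2 on maps of genus zero -/

/-- Functions that are constant along a relation are functions on the quotient. -/
theorem finrank_eq_card_quot (F : Type*) [Field F] {X : Type} [Finite X] (R : X → X → Prop)
    (p : Submodule F (X → F)) (hp : ∀ x, x ∈ p ↔ ∀ a b, R a b → x a = x b) :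
    Module.finrank F p = Nat.card (Quot R) := by
  classical
  have := Fintype.ofFinite (Quot R)
  rw [Nat.card_eq_fintype_card, ← Module.finrank_fintype_fun_eq_card F]
  refine LinearEquiv.finrank_eq
    { toFun := fun x => Quot.lift x.1 ((hp _).mp x.2)
      invFun := fun f => ⟨fun x => f (Quot.mk R x),
        (hp _).mpr fun a b h => congrArg f (Quot.sound h)⟩
      map_add' := fun x y => ?_
      map_smul' := fun k x => ?_
      left_inv := fun x => rfl
      right_inv := fun f => ?_ }
  all_goals
    ext q
    induction q using Quot.ind
    rfl

/-- The functions invariant under a self-map. -/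
def invariantFunctions (F : Type*) [Field F] {X : Type*} (f : X → X) : Submodule F (X → F) where
  carrier := {x | ∀ a, x (f a) = x a}
  add_mem' hx hy a := by simp [hx a, hy a]
  zero_mem' _ := rfl
  smul_mem' k x hx a := by simp [hx a]

theorem finrank_invariantFunctions (F : Type*) [Field F] {X : Type} [Finite X] (f : X → X) :
    Module.finrank F (invariantFunctions F f) = orbitCount f :=
  finrank_eq_card_quot F _ _ fun _ =>
    ⟨fun h a _ hb => hb ▸ (h a).symm, fun h a => (h a _ rfl).symm⟩

theorem finrank_inf_invariantFunctions (F : Type*) [Field F] {X : Type} [Finite X] (f g : X → X) :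
    Module.finrank F (invariantFunctions F f ⊓ invariantFunctions F g : Submodule F (X → F)) =
      jointOrbitCount f g :=
  finrank_eq_card_quot F _ _ fun _ =>
    ⟨fun h a _ hb => hb.elim (fun hb => hb ▸ (h.1 a).symm) (fun hb => hb ▸ (h.2 a).symm),
      fun h => ⟨fun a => (h a _ (Or.inl rfl)).symm, fun a => (h a _ (Or.inr rfl)).symm⟩⟩

/-- On a combinatorial map of genus zero every cycle modulo 2 is the boundary of a sum of faces. -/
theorem exists_potential {H : Type} [Fintype H] (r e : H → H) (hr : Function.Bijective r)
    (he : Function.Involutive e) (hne : ∀ h, e h ≠ h)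
    (euler : orbitCount r + orbitCount (fun h => r (e h)) = orbitCount e + 2 * jointOrbitCount r e)
    (x : H → ZMod 2) (hxe : ∀ h, x (e h) = x h)
    (hx : ∀ y : H → ZMod 2, (∀ h, y (r h) = y h) → ∑ h, x h * y h = 0) :
    ∃ φ : H → ZMod 2, (∀ h, φ (r h) = φ (e h)) ∧ ∀ h, x h = φ h + φ (e h) := by
  classical
  let F := ZMod 2
  let B : LinearMap.BilinForm F (H → F) := dotProductBilin F F
  have hB : ∀ y z, B y z = ∑ h, y h * z h := fun y z => rfl
  have hsymm : ∀ y z, B y z = B z y := fun y z => by simp [hB, mul_comm]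
  have hrefl : B.IsRefl := fun y z h => by rw [hsymm]; exact h
  have hnd : B.Nondegenerate := by
    refine hrefl.nondegenerate_iff_separatingLeft.mpr fun y hy => ?_
    ext h
    simpa [hB, Pi.single_apply] using hy (Pi.single h 1)
  have heq : ∀ a b : F, a + b = 0 ↔ a = b := by decide
  let AE := invariantFunctions F e
  let AV := invariantFunctions F r
  let AF := invariantFunctions F fun h => r (e h)
  let D : (H → F) →ₗ[F] (H → F) := LinearMap.id + LinearMap.funLeft F F e
  have hD : ∀ φ h, D φ h = φ h + φ (e h) := fun φ h => rfl
  have hAF : ∀ φ ∈ AF, ∀ h, φ (r h) = φ (e h) := fun φ hφ h => by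
    have : φ (r (e (e h))) = φ (e h) := hφ (e h)
    rwa [he h] at this
  -- the space of boundaries
  let W := B.orthogonal (AE ⊔ AV)
  have hBW : AF.map D ≤ W := by
    rintro _ ⟨φ, hφ, rfl⟩
    rw [LinearMap.BilinForm.mem_orthogonal_iff]
    intro z hz
    change B z (D φ) = 0
    obtain ⟨y, hy, w, hw, rfl⟩ := Submodule.mem_sup.mp hz
    rw [map_add, LinearMap.add_apply]
    have h1 : B y (D φ) = 0 := by
      simp only [hB, hD, mul_add, Finset.sum_add_distrib]
      rw [heq]
      refine (Function.Bijective.sum_comp he.bijective fun h => y h * φ h).symm.trans ?_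
      exact Finset.sum_congr rfl fun h _ => by rw [hy h]
    have h2 : B w (D φ) = 0 := by
      simp only [hB, hD, mul_add, Finset.sum_add_distrib]
      rw [heq]
      refine (Function.Bijective.sum_comp hr fun h => w h * φ h).symm.trans ?_
      exact Finset.sum_congr rfl fun h _ => by rw [hw h, hAF φ hφ h]
    rw [h1, h2, add_zero]
  have hxW : x ∈ W := by
    rw [LinearMap.BilinForm.mem_orthogonal_iff]
    intro z hz
    change B z x = 0
    obtain ⟨y, hy, w, hw, rfl⟩ := Submodule.mem_sup.mp hz
    rw [map_add, LinearMap.add_apply]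
    have h1 : B y x = 0 := by
      rw [hB]
      refine Finset.sum_involution (fun h _ => e h) (fun h _ => ?_) (fun h _ _ => hne h)
        (fun _ _ => Finset.mem_univ _) (fun h _ => he h)
      rw [heq, hy h, hxe h]
    rw [h1, hsymm, hB, hx w hw, add_zero]
  have hE2 : B.orthogonal AE ≤ AE := by
    intro y hy h
    rw [LinearMap.BilinForm.mem_orthogonal_iff] at hy
    have hs : (Pi.single h 1 + Pi.single (e h) 1 : H → F) ∈ AE := by
      intro a
      have h1 : e a = h ↔ a = e h := ⟨fun h => by rw [← h, he], fun h => by rw [h, he]⟩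
      have h2 : e a = e h ↔ a = h := he.injective.eq_iff
      simp only [Pi.add_apply, Pi.single_apply, h1, h2]
      exact add_comm _ _
    have : B (Pi.single h 1 + Pi.single (e h) 1) y = 0 := hy _ hs
    rw [hB] at this
    simp only [Pi.add_apply, add_mul, Finset.sum_add_distrib, Pi.single_apply, ite_mul, one_mul,
      zero_mul, Finset.sum_ite_eq', Finset.mem_univ, if_true] at this
    exact ((heq _ _).mp this).symm
  -- Write V, E, F, C for the orbit counts in Euler's formula. Then dim `W` = |H| - (E + V - C), and
  -- `hE2` gives |H| ≤ 2E, so dim `W` ≤ E - V + C. By Euler's formula this is F - C, the rank of `D`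
  -- on `AF`, whose kernel consists of the functions constant on connected components. Hence the
  -- inclusion `hBW` is an equality.
  have hdimW := LinearMap.BilinForm.finrank_orthogonal hnd (AE ⊔ AV)
  have hdimE := LinearMap.BilinForm.finrank_orthogonal hnd AE
  have hle := Submodule.finrank_mono hE2
  have hsup := Submodule.finrank_sup_add_finrank_inf_eq AE AV
  have hker : Module.finrank F (LinearMap.ker (D.domRestrict AF)) = jointOrbitCount r e := by
    have hmap : (LinearMap.ker (D.domRestrict AF)).map AF.subtype = AV ⊓ AE := by
      ext φ
      simp only [Submodule.mem_map, LinearMap.mem_ker, Submodule.mem_inf]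
      constructor
      · rintro ⟨ψ, hψ, rfl⟩
        have h1 : ∀ h, ψ.1 (e h) = ψ.1 h := fun h => ((heq _ _).mp (congrFun hψ h)).symm
        exact ⟨fun h => (hAF _ ψ.2 h).trans (h1 h), h1⟩
      · rintro ⟨h1, h2⟩
        refine ⟨⟨φ, fun h => (h1 _).trans (h2 h)⟩, ?_, rfl⟩
        ext h
        exact (heq _ _).mpr (h2 h).symm
    rw [← finrank_inf_invariantFunctions F r e]
    change _ = Module.finrank F (AV ⊓ AE : Submodule F (H → F))
    rw [← hmap]
    exact (Submodule.equivMapOfInjective _ AF.injective_subtype _).finrank_eq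
  have hrank := (D.domRestrict AF).finrank_range_add_finrank_ker
  have hrange : LinearMap.range (D.domRestrict AF) = AF.map D := by
    simp [LinearMap.domRestrict, LinearMap.range_comp]
  have cE : Module.finrank F AE = orbitCount e := finrank_invariantFunctions F e
  have cV : Module.finrank F AV = orbitCount r := finrank_invariantFunctions F r
  have cF : Module.finrank F AF = orbitCount fun h => r (e h) := finrank_invariantFunctions F _
  have cC : Module.finrank F (AE ⊓ AV : Submodule F (H → F)) = jointOrbitCount r e := by
    rw [inf_comm]; exact finrank_inf_invariantFunctions F r e
  have hEle := Submodule.finrank_le AE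
  have hSle := Submodule.finrank_le (AE ⊔ AV)
  rw [hrange] at hrank
  have : AF.map D = W := Submodule.eq_of_le_of_finrank_le hBW (by
    change Module.finrank F W = _ at hdimW
    omega)
  rw [← this] at hxW
  obtain ⟨φ, hφ, rfl⟩ := hxW
  exact ⟨φ, hAF φ hφ, hD φ⟩

/-! ### Dihedral orbits and the endpoints of a component -/

/-- A point fixed by the second of two involutions has a dihedral orbit. -/
theorem apply_zpow_of_involutive {X : Type*} {e p : Equiv.Perm X} (he : Involutive e)
    (hp : Involutive p) {a : X} (ha : p a = a) (k : ℤ) :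
    p (((p * e) ^ k) a) = ((p * e) ^ (-k)) a := by
  have hpp : p * p = 1 := Equiv.ext hp
  have hee : e * e = 1 := Equiv.ext he
  have hinv : (p * e)⁻¹ = p * (p * e) * p⁻¹ := by
    rw [mul_inv_rev, ← mul_assoc, hpp, one_mul, inv_eq_of_mul_eq_one_left hee]
  rw [zpow_neg, ← inv_zpow, hinv, conj_zpow]
  simp [inv_eq_of_mul_eq_one_left hpp, ha]

/-- If two involutions generate a transitive action on an orbit, at most two points of this orbit are
fixed by the second one. -/
theorem not_three_fixed_of_involutive {X : Type*} (e p : Equiv.Perm X) (he : Involutive e)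
    (hp : Involutive p) (a : X) (ha : p a = a) (m n : ℤ)
    (hm : p (((p * e) ^ m) a) = ((p * e) ^ m) a) (hn : p (((p * e) ^ n) a) = ((p * e) ^ n) a)
    (hma : ((p * e) ^ m) a ≠ a) (hna : ((p * e) ^ n) a ≠ a) :
    ((p * e) ^ m) a = ((p * e) ^ n) a := by
  have key := apply_zpow_of_involutive he hp ha
  have hdvd : ∀ k : ℤ, ((p * e) ^ k) a = a ↔ (MulAction.period (p * e) a : ℤ) ∣ k :=
    fun k => MulAction.zpow_smul_eq_iff_period_dvd (j := k) (g := p * e) (a := a)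
  have hdbl : ∀ k : ℤ, p (((p * e) ^ k) a) = ((p * e) ^ k) a →
      (MulAction.period (p * e) a : ℤ) ∣ 2 * k := by
    intro k hk
    rw [key] at hk
    rw [← hdvd, two_mul, zpow_add, Equiv.Perm.mul_apply, ← hk, ← Equiv.Perm.mul_apply, ← zpow_add]
    simp
  -- With N the period of `a`, both 2m and 2n are multiples of N while m and n are not, so they are
  -- odd multiples. Their difference is an even multiple, whence N divides m - n.
  have h0 : ((p * e) ^ (m - n)) a = a := by
    rw [hdvd]
    rw [Ne, hdvd] at hma hna
    obtain ⟨i, hi⟩ := hdbl m hm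
    obtain ⟨j, hj⟩ := hdbl n hn
    generalize (MulAction.period (p * e) a : ℤ) = N at *
    have hodd : ∀ k l : ℤ, 2 * k = N * l → ¬ N ∣ k → Odd l := by
      intro k l hk hN
      by_contra hl
      obtain ⟨t, rfl⟩ := Int.not_odd_iff_even.mp hl
      exact hN ⟨t, by linarith⟩
    obtain ⟨i', rfl⟩ := hodd m i hi hma
    obtain ⟨j', rfl⟩ := hodd n j hj hna
    exact ⟨i' - j', by linarith⟩
  rw [show m = n + (m - n) by ring, zpow_add, Equiv.Perm.mul_apply, h0]

namespace TangleDiagram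

theorem partner_partner (b : Bool) (i : Fin 4) : partner b (partner b i) = i := by
  revert b i; decide

variable {T : TangleDiagram}

theorem Linked.symm {s : T.State} {h g : T.Half} (hl : Linked s h g) : Linked s g h := by
  rcases hl with rfl | ⟨c, i, rfl, rfl⟩
  · exact Or.inl (T.edge_edge _).symm
  · exact Or.inr ⟨c, partner (s c) i, rfl, by rw [partner_partner]⟩

theorem comp_eq_of_linked {s : T.State} {h g : T.Half} (hl : Linked s h g) :
    comp s h = comp s g :=
  congrArg Sum.inl (Quot.sound hl)

theorem comp_edge (s : T.State) (h : T.Half) : comp s (T.edge h) = comp s h :=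
  (comp_eq_of_linked (Or.inl rfl)).symm

theorem comp_partner (s : T.State) (c : Fin T.numCrossings) (i : Fin 4) :
    comp s (Sum.inl (c, partner (s c) i)) = comp s (Sum.inl (c, i)) :=
  (comp_eq_of_linked (Or.inr ⟨c, i, rfl, rfl⟩)).symm

theorem comp_induction {s : T.State} {P : T.Half → Prop} {h g : T.Half}
    (step : ∀ h g, Linked s h g → P h → P g) (hc : comp s h = comp s g) (hP : P h) : P g := by
  have hq : (Quot.mk (Linked s) h) = Quot.mk (Linked s) g := Sum.inl.inj hc
  have : P h = P g :=
    congrArg (Quot.lift P fun a b hl => propext ⟨step a b hl, step b a hl.symm⟩) hq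
  exact this ▸ hP

theorem comp_induction' {s : T.State} {P : T.Half → Prop} {h g : T.Half}
    (hedge : ∀ h, P h → P (T.edge h))
    (hpartner : ∀ c i, P (Sum.inl (c, i)) → P (Sum.inl (c, partner (s c) i)))
    (hc : comp s h = comp s g) (hP : P h) : P g := by
  refine comp_induction ?_ hc hP
  rintro h g (rfl | ⟨c, i, rfl, rfl⟩) h'
  exacts [hedge _ h', hpartner _ _ h']

/-- The involution that joins the half-edges at each crossing according to the smoothing, and fixes
the endpoints. -/
def joinPerm (s : T.State) : Equiv.Perm T.Half :=
  Involutive.toPerm (Sum.elim (fun x => Sum.inl (x.1, partner (s x.1) x.2)) Sum.inr)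
    (by rintro (⟨c, i⟩ | j) <;> simp [partner_partner])

def edgePerm (T : TangleDiagram) : Equiv.Perm T.Half := Involutive.toPerm T.edge T.edge_edge

/-- A component is an orbit of the group generated by the two involutions. Since `joinPerm s` fixes
the endpoint, it maps the n-th point of the cyclic orbit to the (-n)-th. The cyclic orbit is thus
stable under `joinPerm s`, and hence also under the edge involution. -/
theorem exists_zpow_of_comp_eq {s : T.State} {h : T.Half} {j : Fin T.numEnds}
    (hc : comp s (Sum.inr j) = comp s h) :
    ∃ n : ℤ, ((joinPerm s * T.edgePerm) ^ n) (Sum.inr j) = h := by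
  have hp : Involutive (joinPerm s) := Involutive.toPerm_involutive _
  have key := apply_zpow_of_involutive (e := T.edgePerm) (Involutive.toPerm_involutive _) hp
    (show joinPerm s (Sum.inr j) = Sum.inr j from rfl)
  have join : ∀ h, (∃ n : ℤ, ((joinPerm s * T.edgePerm) ^ n) (Sum.inr j) = h) →
      ∃ n : ℤ, ((joinPerm s * T.edgePerm) ^ n) (Sum.inr j) = joinPerm s h := by
    rintro _ ⟨n, rfl⟩
    exact ⟨-n, (key n).symm⟩
  refine comp_induction' (P := fun h => ∃ n : ℤ, ((joinPerm s * T.edgePerm) ^ n) (Sum.inr j) = h) ?_ ?_ hc ⟨0, rfl⟩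
  · rintro _ ⟨n, rfl⟩
    obtain ⟨m, hm⟩ := join (joinPerm s (T.edgePerm (((joinPerm s * T.edgePerm) ^ n) (Sum.inr j))))
      ⟨1 + n, by rw [zpow_add, zpow_one]; rfl⟩
    exact ⟨m, hm.trans (hp _)⟩
  · intro c i h
    exact join _ h

/-- A component of a smoothed diagram has at most two endpoints. -/
theorem end_eq_of_comp_eq {s : T.State} {i j k : Fin T.numEnds}
    (hij : comp s (Sum.inr i) = comp s (Sum.inr j)) (hik : comp s (Sum.inr i) = comp s (Sum.inr k))
    (hj : i ≠ j) (hk : i ≠ k) : j = k := by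
  obtain ⟨m, hm⟩ := exists_zpow_of_comp_eq hij
  obtain ⟨n, hn⟩ := exists_zpow_of_comp_eq hik
  have := not_three_fixed_of_involutive T.edgePerm (joinPerm s) (Involutive.toPerm_involutive _)
    (Involutive.toPerm_involutive _) (Sum.inr i) rfl m n (by rw [hm]; rfl) (by rw [hn]; rfl)
    (by rw [hm]; exact fun h => hj (Sum.inr.inj h).symm)
    (by rw [hn]; exact fun h => hk (Sum.inr.inj h).symm)
  rw [hm, hn] at this
  exact Sum.inr.inj this

end TangleDiagram

/-! ### The Jordan curve argument for the added arc -/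

theorem HalfEdge.rotation_bijective (n m : ℕ) : Bijective (HalfEdge.rotation n m) := by
  refine Finite.injective_iff_bijective.mp ?_
  rintro (⟨c, i⟩ | j) (⟨d, k⟩ | l) h
  · simpa [HalfEdge.rotation] using h
  · exact absurd h Sum.inl_ne_inr
  · exact absurd h Sum.inr_ne_inl
  · exact congrArg _ ((finRotate m).symm.injective (Sum.inr.inj h))

theorem Fin.apply_eq_of_finRotate {α : Type*} {m : ℕ} (f : Fin m → α)
    (hf : ∀ j, f ((finRotate m).symm j) = f j) (i j : Fin m) : f i = f j := by
  cases m with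
  | zero => exact i.elim0
  | succ n =>
    have h : ∀ i, f i = f 0 := by
      intro i
      induction i using Fin.induction with
      | zero => rfl
      | succ i ih =>
        rw [← ih, ← hf i.succ, (finRotate (n + 1)).symm_apply_eq.mpr]
        rw [finRotate_apply, Fin.coeSucc_eq_succ]
    rw [h i, h j]

namespace ArcAddition

open TangleDiagram

variable {T T' : TangleDiagram} (A : ArcAddition T T')

/-- The half-edges of `T`, as half-edges of `T'`. -/
def halfMap : T.Half → T'.Half := Sum.map (Prod.map A.crossingMap id) A.endMap

theorem halfMap_injective : Injective A.halfMap :=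
  (A.crossingMap.injective.prodMap injective_id).sumMap A.endMap.injective

theorem crossingMap_ne (c : Fin T.numCrossings) : A.crossingMap c ≠ A.crossing := by
  have : A.crossingMap c ∈ Set.range A.crossingMap := ⟨c, rfl⟩
  rw [A.range_crossingMap] at this
  exact this

theorem crossing_cases (c : Fin T'.numCrossings) : c = A.crossing ∨ ∃ d, A.crossingMap d = c := by
  by_contra! h
  have : c ∈ Set.range A.crossingMap := by
    rw [A.range_crossingMap]; exact h.1
  obtain ⟨d, hd⟩ := this
  exact h.2 d hd

theorem end_cases (j : Fin T'.numEnds) :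
    (j = A.startPt ∨ j = A.endPt) ∨ ∃ i, A.endMap i = j := by
  by_contra! h
  have : j ∈ Set.range A.endMap := by
    rw [A.range_endMap]; simp [h.1]
  obtain ⟨d, hd⟩ := this
  exact h.2 d hd

theorem endMap_ne (j : Fin T.numEnds) : A.endMap j ≠ A.startPt ∧ A.endMap j ≠ A.endPt := by
  have : A.endMap j ∈ Set.range A.endMap := ⟨j, rfl⟩
  rw [A.range_endMap] at this
  simpa using this

theorem half_cases (h : T'.Half) : (∃ g, A.halfMap g = h) ∨ (∃ i, h = Sum.inl (A.crossing, i)) ∨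
    h = Sum.inr A.startPt ∨ h = Sum.inr A.endPt := by
  rcases h with ⟨c, i⟩ | j
  · rcases A.crossing_cases c with rfl | ⟨d, rfl⟩
    · exact Or.inr (Or.inl ⟨i, rfl⟩)
    · exact Or.inl ⟨Sum.inl (d, i), rfl⟩
  · rcases A.end_cases j with (rfl | rfl) | ⟨d, rfl⟩
    · exact Or.inr (Or.inr (Or.inl rfl))
    · exact Or.inr (Or.inr (Or.inr rfl))
    · exact Or.inl ⟨Sum.inr d, rfl⟩

theorem halfMap_ne_crossing (h : T.Half) (i : Fin 4) :
    A.halfMap h ≠ Sum.inl (A.crossing, i) := by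
  rcases h with ⟨c, k⟩ | j
  · intro h
    exact A.crossingMap_ne c (congrArg Prod.fst (Sum.inl.inj h))
  · exact Sum.inr_ne_inl

theorem halfMap_ne_startPt (h : T.Half) : A.halfMap h ≠ Sum.inr A.startPt := by
  rcases h with ⟨c, k⟩ | j
  · exact Sum.inl_ne_inr
  · exact fun h => (A.endMap_ne j).1 (Sum.inr.inj h)

theorem halfMap_ne_endPt (h : T.Half) : A.halfMap h ≠ Sum.inr A.endPt := by
  rcases h with ⟨c, k⟩ | j
  · exact Sum.inl_ne_inr
  · exact fun h => (A.endMap_ne j).2 (Sum.inr.inj h)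

theorem slot_cases (i : Fin 4) :
    i = A.slot ∨ i = A.slot + 1 ∨ i = A.slot + 2 ∨ i = A.slot + 3 := by
  generalize A.slot = k
  revert i k; decide

theorem edge_slot : T'.edge (Sum.inl (A.crossing, A.slot)) = Sum.inr A.startPt := by
  rw [← A.edge_startPt, T'.edge_edge]

theorem edge_slot_add_two : T'.edge (Sum.inl (A.crossing, A.slot + 2)) = Sum.inr A.endPt := by
  rw [← A.edge_endPt, T'.edge_edge]

theorem startPt_ne_endPt : A.startPt ≠ A.endPt := by
  intro h
  have h1 := A.edge_startPt
  rw [h, A.edge_endPt] at h1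
  have h2 := congrArg Prod.snd (Sum.inl.inj h1)
  have hne : ∀ k : Fin 4, k + 2 ≠ k := by decide
  exact hne _ h2

/-- No closed curve on `T'` that avoids the boundary crosses the added arc exactly once. -/
theorem no_closed_curve (x : T'.Half → ZMod 2) (hedge : ∀ h, x (T'.edge h) = x h)
    (hcrossing : ∀ c, ∑ i, x (Sum.inl (c, i)) = 0) (hend : ∀ j, x (Sum.inr j) = 0)
    (hslot : x (Sum.inl (A.crossing, A.slot + 1)) = 1) : False := by
  have heq : ∀ a b : ZMod 2, a + b = 0 ↔ a = b := by decide
  obtain ⟨φ, h1, h2⟩ := exists_potential (HalfEdge.rotation T'.numCrossings T'.numEnds) T'.edge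
    (HalfEdge.rotation_bijective _ _) T'.edge_edge T'.edge_ne T'.planar x hedge (by
      intro y hy
      rw [Fintype.sum_sum_type, Fintype.sum_prod_type]
      simp only [hend, zero_mul, Finset.sum_const_zero, add_zero]
      refine Finset.sum_eq_zero fun c _ => ?_
      have : ∀ i, y (Sum.inl (c, i + 1)) = y (Sum.inl (c, i)) := fun i => hy (Sum.inl (c, i))
      have h1 : y (Sum.inl (c, 1)) = y (Sum.inl (c, 0)) := this 0
      have h2 : y (Sum.inl (c, 2)) = y (Sum.inl (c, 1)) := this 1
      have h3 : y (Sum.inl (c, 3)) = y (Sum.inl (c, 2)) := this 2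
      have := hcrossing c
      rw [Fin.sum_univ_four] at this ⊢
      rw [h3, h2, h1, ← add_mul, ← add_mul, ← add_mul, this, zero_mul])
  -- The curve uses no edge at the boundary circle, so the colour `φ` does not change from one
  -- endpoint to the next.
  have hb : ∀ i j, φ (Sum.inr i) = φ (Sum.inr j) :=
    Fin.apply_eq_of_finRotate (fun j => φ (Sum.inr j)) fun j =>
      (h1 (Sum.inr j)).trans ((heq _ _).mp ((h2 _).symm.trans (hend j))).symm
  -- The faces on the two sides of the edge at `slot + 1` also lie along the two parts of the added
  -- arc, so their colours are those at `startPt` and `endPt`. These agree, although this edge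
  -- belongs to the curve.
  have hrot : ∀ i, φ (Sum.inl (A.crossing, i + 1)) = φ (T'.edge (Sum.inl (A.crossing, i))) :=
    fun i => h1 (Sum.inl (A.crossing, i))
  have e0 := hrot A.slot
  have e1 := hrot (A.slot + 1)
  have x1 := h2 (Sum.inl (A.crossing, A.slot + 1))
  have x2 := h2 (Sum.inr A.endPt)
  rw [hslot] at x1
  rw [hend, A.edge_endPt] at x2
  rw [A.edge_slot] at e0
  rw [show A.slot + 1 + 1 = A.slot + 2 by rw [add_assoc]; rfl] at e1
  rw [← e1, ← (heq _ _).mp x2.symm, e0, hb A.startPt A.endPt] at x1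
  rw [(heq _ _).mpr rfl] at x1
  exact one_ne_zero x1

/-- `edge_map` does not assert that some edge of `T` is crossed: a priori `slot + 1` could be joined
to `slot + 3`. That would be a loop meeting the arc once, which `no_closed_curve` excludes. -/
theorem exists_cut : ∃ h, T'.edge (Sum.inl (A.crossing, A.slot + 1)) = A.halfMap h ∧
    T'.edge (Sum.inl (A.crossing, A.slot + 3)) = A.halfMap (T.edge h) := by
  classical
  have hne : ∀ k : Fin 4, k ≠ k + 1 ∧ k + 2 ≠ k + 1 ∧ k + 1 ≠ k + 3 ∧ k ≠ k + 3 ∧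
      k + 2 ≠ k + 3 := by decide
  obtain ⟨hn1, hn2, hn3, hn4, hn5⟩ := hne A.slot
  have hcross : ∀ i, T'.edge (Sum.inl (A.crossing, A.slot + 1)) ≠ Sum.inl (A.crossing, i) := by
    intro i hi
    have hi' := congrArg T'.edge hi
    rw [T'.edge_edge] at hi'
    rcases A.slot_cases i with rfl | rfl | rfl | rfl
    · rw [A.edge_slot] at hi'
      exact Sum.inl_ne_inr hi'
    · exact T'.edge_ne _ hi
    · rw [A.edge_slot_add_two] at hi'
      exact Sum.inl_ne_inr hi'
    · -- the arc would cross a loop without further crossings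
      refine A.no_closed_curve (fun h => if h = Sum.inl (A.crossing, A.slot + 1) ∨
        h = Sum.inl (A.crossing, A.slot + 3) then 1 else 0) (fun h => ?_) (fun c => ?_)
        (fun j => by simp) (by simp)
      · refine if_congr ?_ rfl rfl
        have e1 : ∀ g, T'.edge h = g ↔ h = T'.edge g := fun g =>
          ⟨fun h => by rw [← h, T'.edge_edge], fun h => by rw [h, T'.edge_edge]⟩
        rw [e1, e1, hi, ← hi', or_comm]
      · by_cases hc : c = A.crossing
        · subst hc
          simp only [Sum.inl.injEq, Prod.mk.injEq, true_and]
          generalize A.slot = k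
          revert k
          decide
        · simp [hc]
  rcases A.half_cases (T'.edge (Sum.inl (A.crossing, A.slot + 1))) with ⟨g, hg⟩ | ⟨i, hi⟩ | h | h
  · refine ⟨g, hg.symm, ?_⟩
    have hg' : T'.edge (A.halfMap g) = Sum.inl (A.crossing, A.slot + 1) := by
      rw [hg, T'.edge_edge]
    rcases A.edge_map g with h | ⟨-, h⟩ | ⟨h, -⟩
    · exact absurd (h.symm.trans hg') (A.halfMap_ne_crossing _ _)
    · exact (congrArg T'.edge h).symm.trans (T'.edge_edge _)
    · have := congrArg Prod.snd (Sum.inl.inj (hg'.symm.trans h))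
      exact absurd this hn3
  · exact absurd hi (hcross i)
  · have := congrArg T'.edge h
    rw [T'.edge_edge, A.edge_startPt] at this
    exact absurd (congrArg Prod.snd (Sum.inl.inj this)).symm hn1
  · have := congrArg T'.edge h
    rw [T'.edge_edge, A.edge_endPt] at this
    exact absurd (congrArg Prod.snd (Sum.inl.inj this)).symm hn2

/-- A half of the edge of `T` that is crossed by the added arc. -/
noncomputable def cut : T.Half := A.exists_cut.choose

theorem edge_slot_add_one :
    T'.edge (Sum.inl (A.crossing, A.slot + 1)) = A.halfMap A.cut := A.exists_cut.choose_spec.1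

theorem edge_slot_add_three :
    T'.edge (Sum.inl (A.crossing, A.slot + 3)) = A.halfMap (T.edge A.cut) :=
  A.exists_cut.choose_spec.2

theorem edge_halfMap (h : T.Half) : T'.edge (A.halfMap h) = A.halfMap (T.edge h) ∨
    (h = A.cut ∧ T'.edge (A.halfMap h) = Sum.inl (A.crossing, A.slot + 1)) ∨
    (h = T.edge A.cut ∧ T'.edge (A.halfMap h) = Sum.inl (A.crossing, A.slot + 3)) := by
  rcases A.edge_map h with h1 | ⟨h1, -⟩ | ⟨h1, -⟩
  · exact Or.inl h1
  · refine Or.inr (Or.inl ⟨A.halfMap_injective ?_, h1⟩)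
    rw [← A.edge_slot_add_one]
    exact (T'.edge_edge _).symm.trans (congrArg T'.edge h1)
  · refine Or.inr (Or.inr ⟨A.halfMap_injective ?_, h1⟩)
    rw [← A.edge_slot_add_three]
    exact (T'.edge_edge _).symm.trans (congrArg T'.edge h1)

/-- In every smoothing of `T`, the component that meets the added arc is an arc. -/
theorem isArc_comp_cut (s : T.State) : IsArc (comp s A.cut) := by
  classical
  by_contra harc
  -- The supposed circle drawn in `T'`: its half-edges in `T`, and the two slots of the new crossing
  -- through which it passes straight across the added arc.
  let x : T'.Half → ZMod 2 := extend A.halfMap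
    (fun h => if comp s h = comp s A.cut then 1 else 0)
    (fun h => if h = Sum.inl (A.crossing, A.slot + 1) ∨ h = Sum.inl (A.crossing, A.slot + 3)
      then 1 else 0)
  have xmap : ∀ h, x (A.halfMap h) = if comp s h = comp s A.cut then 1 else 0 :=
    fun h => A.halfMap_injective.extend_apply _ _ _
  have xother : ∀ h, (∀ g, A.halfMap g ≠ h) → x h = if h = Sum.inl (A.crossing, A.slot + 1) ∨
      h = Sum.inl (A.crossing, A.slot + 3) then 1 else 0 :=
    fun h hh => extend_apply' _ _ _ fun ⟨g, hg⟩ => hh g hg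
  have xstart : x (Sum.inr A.startPt) = 0 := by
    rw [xother _ A.halfMap_ne_startPt]; simp
  have xend : x (Sum.inr A.endPt) = 0 := by
    rw [xother _ A.halfMap_ne_endPt]; simp
  have xcross : ∀ i, x (Sum.inl (A.crossing, i)) =
      if i = A.slot + 1 ∨ i = A.slot + 3 then 1 else 0 := by
    intro i
    rw [xother _ fun g => A.halfMap_ne_crossing g i]
    simp
  have hne : ∀ k : Fin 4, ¬ (k = k + 1 ∨ k = k + 3) ∧ ¬ (k + 2 = k + 1 ∨ k + 2 = k + 3) := by
    decide
  refine A.no_closed_curve x (fun h => ?_) (fun c => ?_) (fun j => ?_) ?_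
  · rcases A.half_cases h with ⟨g, rfl⟩ | ⟨i, rfl⟩ | rfl | rfl
    · rcases A.edge_halfMap g with h | ⟨rfl, h⟩ | ⟨rfl, h⟩
      · rw [h, xmap, xmap, comp_edge]
      · rw [h, xmap, xcross]; simp
      · rw [h, xmap, xcross]; simp [comp_edge]
    · rcases A.slot_cases i with rfl | rfl | rfl | rfl
      · rw [A.edge_slot, xstart, xcross, if_neg (hne _).1]
      · rw [A.edge_slot_add_one, xmap, xcross]; simp
      · rw [A.edge_slot_add_two, xend, xcross, if_neg (hne _).2]
      · rw [A.edge_slot_add_three, xmap, xcross]; simp [comp_edge]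
    · rw [A.edge_startPt, xstart, xcross, if_neg (hne _).1]
    · rw [A.edge_endPt, xend, xcross, if_neg (hne _).2]
  · rcases A.crossing_cases c with rfl | ⟨d, rfl⟩
    · simp only [xcross]
      generalize A.slot = k
      revert k
      decide
    · have hx : ∀ i, x (Sum.inl (A.crossingMap d, i)) =
          if comp s (Sum.inl (d, i)) = comp s A.cut then 1 else 0 := fun i => xmap (Sum.inl (d, i))
      have hp := comp_partner s d
      -- The smoothing pairs the four slots and each pair lies on one component, so the sum cancels
      -- modulo 2.
      simp only [hx, Fin.sum_univ_four]
      have hdbl : ∀ a b : ZMod 2, a + a + b + b = 0 ∧ a + b + b + a = 0 := by decide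
      cases hd : s d <;> rw [hd] at hp
      · have h0 := hp 0
        have h2 := hp 2
        simp only [partner, Matrix.cons_val] at h0 h2
        rw [h0, h2]
        exact (hdbl _ _).1
      · have h0 := hp 0
        have h1 := hp 1
        simp only [partner, Matrix.cons_val] at h0 h1
        rw [h0, h1]
        exact (hdbl _ _).2
  · rcases A.end_cases j with (rfl | rfl) | ⟨i, rfl⟩
    · exact xstart
    · exact xend
    · refine (xmap (Sum.inr i)).trans (if_neg fun h => harc ⟨i, h.symm⟩)
  · rw [xcross]; simp

end ArcAddition

/-! ### Components and labellings of the smoothings of `T'` over those of `T` -/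

namespace ArcAddition

open TangleDiagram

variable {T T' : TangleDiagram} (A : ArcAddition T T')

/-- The state `s'` of `T'` restricts to the state `s` of `T`. -/
def Over (s : T.State) (s' : T'.State) : Prop := ∀ c, s' (A.crossingMap c) = s c

/-- The retraction of the half-edges of `T'` that moves the added arc onto the edge that it cuts. -/
noncomputable def proj : T'.Half → T.Half := extend A.halfMap id fun _ => A.cut

@[simp]
theorem proj_halfMap (h : T.Half) : A.proj (A.halfMap h) = h := A.halfMap_injective.extend_apply _ _ _

@[simp]
theorem proj_crossing (i : Fin 4) : A.proj (Sum.inl (A.crossing, i)) = A.cut :=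
  extend_apply' _ _ _ fun ⟨g, hg⟩ => A.halfMap_ne_crossing g i hg

@[simp]
theorem proj_startPt : A.proj (Sum.inr A.startPt) = A.cut :=
  extend_apply' _ _ _ fun ⟨g, hg⟩ => A.halfMap_ne_startPt g hg

@[simp]
theorem proj_endPt : A.proj (Sum.inr A.endPt) = A.cut :=
  extend_apply' _ _ _ fun ⟨g, hg⟩ => A.halfMap_ne_endPt g hg

@[simp]
theorem proj_crossingMap (c : Fin T.numCrossings) (i : Fin 4) :
    A.proj (Sum.inl (A.crossingMap c, i)) = Sum.inl (c, i) := A.proj_halfMap (Sum.inl (c, i))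

@[simp]
theorem proj_endMap (j : Fin T.numEnds) : A.proj (Sum.inr (A.endMap j)) = Sum.inr j :=
  A.proj_halfMap (Sum.inr j)

theorem comp_proj_edge (s : T.State) (h : T'.Half) :
    comp s (A.proj (T'.edge h)) = comp s (A.proj h) := by
  rcases A.half_cases h with ⟨g, rfl⟩ | ⟨i, rfl⟩ | rfl | rfl
  · rcases A.edge_halfMap g with h | ⟨rfl, h⟩ | ⟨rfl, h⟩ <;> simp [h, comp_edge]
  · rcases A.slot_cases i with rfl | rfl | rfl | rfl
    · simp [A.edge_slot]
    · simp [A.edge_slot_add_one]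
    · simp [A.edge_slot_add_two]
    · simp [A.edge_slot_add_three, comp_edge]
  · simp [A.edge_startPt]
  · simp [A.edge_endPt]

variable {A} in
theorem Over.comp_proj_eq {s : T.State} {s' : T'.State} (hs : A.Over s s') {h g : T'.Half}
    (hl : Linked s' h g) : comp s (A.proj h) = comp s (A.proj g) := by
  rcases hl with rfl | ⟨c, i, rfl, rfl⟩
  · exact (A.comp_proj_edge s h).symm
  · rcases A.crossing_cases c with rfl | ⟨d, rfl⟩
    · simp
    · rw [proj_crossingMap, proj_crossingMap, hs, comp_partner]

variable {A} {s : T.State} {s' : T'.State}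

/-- The component of `T_s` that contains a component of `T'_s'`, the two parts of the added arc
being retracted onto the edge that it cuts. -/
noncomputable def Over.proj (hs : A.Over s s') : Component s' → Component s :=
  Sum.elim (Quot.lift (fun h => comp s (A.proj h)) fun _ _ => hs.comp_proj_eq)
    fun k => Sum.inr (k.cast A.numLoops_eq)

namespace Over

variable (hs : A.Over s s')

theorem proj_comp (h : T'.Half) : hs.proj (comp s' h) = comp s (A.proj h) := rfl

theorem proj_comp_halfMap (h : T.Half) : hs.proj (comp s' (A.halfMap h)) = comp s h := by
  rw [proj_comp, proj_halfMap]

theorem proj_loop (k : Fin T'.numLoops) : hs.proj (Sum.inr k) = Sum.inr (k.cast A.numLoops_eq) :=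
  rfl

theorem comp_slot (s' : T'.State) :
    comp s' (Sum.inl (A.crossing, A.slot)) = comp s' (Sum.inr A.startPt) := by
  rw [← comp_edge, A.edge_slot]

theorem comp_slot_add_two (s' : T'.State) :
    comp s' (Sum.inl (A.crossing, A.slot + 2)) = comp s' (Sum.inr A.endPt) := by
  rw [← comp_edge, A.edge_slot_add_two]

/-- Either smoothing joins adjacent slots, so it attaches the two ends of the cut edge to the two
parts of the arc, in one order or the other. -/
theorem comp_slot_add_one_or_three (s' : T'.State) :
    (comp s' (Sum.inl (A.crossing, A.slot + 1)) = comp s' (Sum.inr A.startPt) ∧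
      comp s' (Sum.inl (A.crossing, A.slot + 3)) = comp s' (Sum.inr A.endPt)) ∨
    (comp s' (Sum.inl (A.crossing, A.slot + 1)) = comp s' (Sum.inr A.endPt) ∧
      comp s' (Sum.inl (A.crossing, A.slot + 3)) = comp s' (Sum.inr A.startPt)) := by
  rw [← comp_slot, ← comp_slot_add_two]
  have h1 := comp_partner s' A.crossing (A.slot + 1)
  have h3 := comp_partner s' A.crossing (A.slot + 3)
  have : ∀ (k : Fin 4) (b : Bool), (partner b (k + 1) = k ∧ partner b (k + 3) = k + 2) ∨
    (partner b (k + 1) = k + 2 ∧ partner b (k + 3) = k) := by decide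
  rcases this A.slot (s' A.crossing) with ⟨e1, e3⟩ | ⟨e1, e3⟩
  · rw [e1] at h1; rw [e3] at h3
    exact Or.inl ⟨h1.symm, h3.symm⟩
  · rw [e1] at h1; rw [e3] at h3
    exact Or.inr ⟨h1.symm, h3.symm⟩

theorem comp_crossing (s' : T'.State) (i : Fin 4) :
    comp s' (Sum.inl (A.crossing, i)) = comp s' (Sum.inr A.startPt) ∨
      comp s' (Sum.inl (A.crossing, i)) = comp s' (Sum.inr A.endPt) := by
  rcases A.slot_cases i with rfl | rfl | rfl | rfl
  · exact Or.inl (comp_slot s')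
  · exact (comp_slot_add_one_or_three s').imp And.left And.left
  · exact Or.inr (comp_slot_add_two s')
  · exact (comp_slot_add_one_or_three s').symm.imp And.right And.right

theorem comp_cut_or (s' : T'.State) :
    (comp s' (A.halfMap A.cut) = comp s' (Sum.inr A.startPt) ∨
      comp s' (A.halfMap A.cut) = comp s' (Sum.inr A.endPt)) ∧
    (comp s' (A.halfMap (T.edge A.cut)) = comp s' (Sum.inr A.startPt) ∨
      comp s' (A.halfMap (T.edge A.cut)) = comp s' (Sum.inr A.endPt)) := by
  rw [← A.edge_slot_add_one, ← A.edge_slot_add_three, comp_edge, comp_edge]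
  exact ⟨comp_crossing s' _, comp_crossing s' _⟩

/-- Over the component that meets the added arc there are only the components of its two ends. -/
theorem eq_start_or_end (x : Component s') (hx : hs.proj x = comp s A.cut) :
    x = comp s' (Sum.inr A.startPt) ∨ x = comp s' (Sum.inr A.endPt) := by
  have key : ∀ h : T.Half, comp s h = comp s A.cut →
      comp s' (A.halfMap h) = comp s' (Sum.inr A.startPt) ∨
        comp s' (A.halfMap h) = comp s' (Sum.inr A.endPt) := by
    intro h hh
    refine comp_induction' (P := fun h => comp s' (A.halfMap h) = comp s' (Sum.inr A.startPt) ∨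
        comp s' (A.halfMap h) = comp s' (Sum.inr A.endPt)) ?_ ?_ hh.symm (comp_cut_or s').1
    · intro h hP
      rcases A.edge_halfMap h with h1 | ⟨rfl, -⟩ | ⟨rfl, -⟩
      · rwa [← h1, comp_edge]
      · exact (comp_cut_or s').2
      · rw [T.edge_edge]; exact (comp_cut_or s').1
    · intro c i hP
      have := comp_partner s' (A.crossingMap c) i
      rw [hs] at this
      change comp s' (Sum.inl (A.crossingMap c, partner (s c) i)) = _ ∨
        comp s' (Sum.inl (A.crossingMap c, partner (s c) i)) = _
      rw [this]
      exact hP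
  rcases x with q | k
  · induction q using Quot.ind with | mk h =>
    change comp s (A.proj h) = _ at hx
    change comp s' h = _ ∨ comp s' h = _
    rcases A.half_cases h with ⟨g, rfl⟩ | ⟨i, rfl⟩ | rfl | rfl
    · exact key g (by rwa [proj_halfMap] at hx)
    · exact comp_crossing s' i
    · exact Or.inl rfl
    · exact Or.inr rfl
  · exact absurd hx Sum.inr_ne_inl

/-- A path in `T_s` off the component of the cut edge never runs along that edge, so it survives in
`T'`. -/
theorem comp_halfMap_eq (hs : A.Over s s') {h g : T.Half} (hc : comp s h = comp s g) (hne : comp s h ≠ comp s A.cut) :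
    comp s' (A.halfMap h) = comp s' (A.halfMap g) := by
  have : comp s g ≠ comp s A.cut ∧ comp s' (A.halfMap h) = comp s' (A.halfMap g) := by
    refine comp_induction' (P := fun g => comp s g ≠ comp s A.cut ∧
      comp s' (A.halfMap h) = comp s' (A.halfMap g)) ?_ ?_ hc ⟨hne, rfl⟩
    · rintro k ⟨h1, h2⟩
      refine ⟨by rwa [comp_edge], ?_⟩
      rcases A.edge_halfMap k with h3 | ⟨rfl, -⟩ | ⟨rfl, -⟩
      · rw [← h3, comp_edge, h2]
      · exact absurd rfl h1
      · exact absurd (comp_edge _ _) h1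
    · rintro c i ⟨h1, h2⟩
      refine ⟨by rwa [comp_partner], ?_⟩
      have := comp_partner s' (A.crossingMap c) i
      rw [hs] at this
      exact h2.trans this.symm
  exact this.2

theorem proj_injOn {x y : Component s'} (hxy : hs.proj x = hs.proj y)
    (hne : hs.proj x ≠ comp s A.cut) : x = y := by
  have key : ∀ h : T'.Half, hs.proj (comp s' h) ≠ comp s A.cut →
      comp s' h = comp s' (A.halfMap (A.proj h)) := by
    intro h hh
    rw [proj_comp] at hh
    rcases A.half_cases h with ⟨g, rfl⟩ | ⟨i, rfl⟩ | rfl | rfl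
    · rw [proj_halfMap]
    · exact absurd (by rw [proj_crossing]) hh
    · exact absurd (by rw [proj_startPt]) hh
    · exact absurd (by rw [proj_endPt]) hh
  rcases x with q | k <;> rcases y with q' | k'
  · induction q using Quot.ind with | mk h =>
    induction q' using Quot.ind with | mk g =>
    change comp s' h = comp s' g
    rw [key h hne, key g (hxy ▸ hne)]
    exact hs.comp_halfMap_eq hxy hne
  · induction q using Quot.ind
    exact absurd hxy Sum.inl_ne_inr
  · induction q' using Quot.ind
    exact absurd hxy Sum.inr_ne_inl
  · rw [proj_loop, proj_loop] at hxy
    simpa using hxy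

theorem proj_surjective : Surjective hs.proj := by
  rintro (q | k)
  · induction q using Quot.ind with | mk h =>
    exact ⟨_, hs.proj_comp_halfMap h⟩
  · exact ⟨Sum.inr (k.cast A.numLoops_eq.symm), rfl⟩

/-- The two parts of the added arc lie on different components. -/
theorem comp_start_ne_end (hs : A.Over s s') :
    comp s' (Sum.inr A.startPt) ≠ comp s' (Sum.inr A.endPt) := by
  intro h
  -- The arc through the cut edge has an endpoint `j` in `T`. If the two parts of the added arc were
  -- connected, their component would have the three endpoints `startPt`, `endPt` and `endMap j`.
  obtain ⟨j, hj⟩ := A.isArc_comp_cut s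
  have h1 : comp s' (Sum.inr A.startPt) = comp s' (Sum.inr (A.endMap j)) := by
    rcases hs.eq_start_or_end (comp s' (Sum.inr (A.endMap j)))
      (by rw [proj_comp, proj_endMap, hj]) with h1 | h1
    · exact h1.symm
    · exact h.trans h1.symm
  exact (A.endMap_ne j).2 (end_eq_of_comp_eq h h1 A.startPt_ne_endPt (A.endMap_ne j).1.symm).symm

theorem isArc_proj (x : Component s') : IsArc (hs.proj x) ↔ IsArc x := by
  constructor
  · rintro ⟨j, hj⟩
    by_cases h : hs.proj x = comp s A.cut
    · rcases hs.eq_start_or_end x h with rfl | rfl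
      exacts [⟨_, rfl⟩, ⟨_, rfl⟩]
    · exact ⟨A.endMap j, hs.proj_injOn (by rw [hj, proj_comp, proj_endMap]) h⟩
  · rintro ⟨j, rfl⟩
    rw [proj_comp]
    rcases A.end_cases j with (rfl | rfl) | ⟨i, rfl⟩
    · rw [proj_startPt]; exact A.isArc_comp_cut s
    · rw [proj_endPt]; exact A.isArc_comp_cut s
    · rw [proj_endMap]; exact ⟨i, rfl⟩

/-- Labellings of `T_s` are pulled back to `T'_s'`. -/
noncomputable def pullback (l : Labelling s) : Labelling s' :=
  ⟨fun x => l.1 (hs.proj x), fun x => (l.2 _).trans (hs.isArc_proj x)⟩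

/-- Two components with the same image both lie over the cut arc and are arcs, so the label `w` is
forced on each. Every labelling therefore descends. -/
theorem pullback_bijective : Bijective hs.pullback := by
  constructor
  · intro l m h
    ext y
    obtain ⟨x, rfl⟩ := hs.proj_surjective y
    exact congrFun (congrArg Subtype.val h) x
  · intro l
    have hr : ∀ x, l.1 (surjInv hs.proj_surjective (hs.proj x)) = l.1 x := by
      intro x
      have h := surjInv_eq hs.proj_surjective (hs.proj x)
      by_cases hx : hs.proj x = comp s A.cut
      · have harc := A.isArc_comp_cut s
        rw [(l.2 x).mpr, (l.2 _).mpr]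
        · rwa [← hs.isArc_proj, h, hx]
        · rwa [← hs.isArc_proj, hx]
      · rw [hs.proj_injOn h (by rwa [h])]
    refine ⟨⟨fun y => l.1 (surjInv hs.proj_surjective y), fun y => ?_⟩, ?_⟩
    · obtain ⟨x, rfl⟩ := hs.proj_surjective y
      exact (iff_of_eq (congrArg (· = _) (hr x))).trans ((l.2 x).trans (hs.isArc_proj x).symm)
    · ext x
      exact hr x

/-- The cut arc has two preimages and every other component has one, so the sum gains exactly one
label `w`, of degree -1. Omitting the component of `endPt` leaves a bijection. -/
theorem sum_deg_pullback (l : Labelling s) :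
    ∑ x, ((hs.pullback l).1 x).deg = ∑ x, (l.1 x).deg - 1 := by
  classical
  have hend : hs.proj (comp s' (Sum.inr A.endPt)) = comp s A.cut := by
    rw [proj_comp, proj_endPt]
  have hw : l.1 (comp s A.cut) = TangleGen.w := (l.2 _).mpr (A.isArc_comp_cut s)
  rw [← Finset.sum_erase_add _ _ (Finset.mem_univ (comp s' (Sum.inr A.endPt)))]
  have h1 : ((hs.pullback l).1 (comp s' (Sum.inr A.endPt))).deg = -1 := by
    change (l.1 (hs.proj _)).deg = -1
    rw [hend, hw]; rfl
  rw [h1, ← sub_eq_add_neg]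
  congr 1
  refine Finset.sum_bij (fun x _ => hs.proj x) (fun _ _ => Finset.mem_univ _) ?_ ?_
    (fun _ _ => rfl)
  · intro x hx y hy hxy
    rw [Finset.mem_erase] at hx hy
    by_cases h : hs.proj x = comp s A.cut
    · rw [(hs.eq_start_or_end x h).resolve_right hx.1,
        (hs.eq_start_or_end y (hxy ▸ h)).resolve_right hy.1]
    · exact hs.proj_injOn hxy h
  · intro y _
    by_cases h : y = comp s A.cut
    · refine ⟨comp s' (Sum.inr A.startPt), ?_, ?_⟩
      · simpa using hs.comp_start_ne_end
      · rw [proj_comp, proj_startPt, h]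
    · obtain ⟨x, rfl⟩ := hs.proj_surjective y
      exact ⟨x, by simpa using fun hx : x = _ => h (by rw [hx, hend]), rfl⟩

end Over

end ArcAddition

/-! ### Comparison of the saddle maps -/

theorem eq_and_ne_of_pair {α β : Type*} (f : α → β) {p q a b : α} (hpq : p ≠ q) (h : f p = f q)
    (hp : p = a ∨ p = b) (hq : q = a ∨ q = b) : f a = f b ∧ a ≠ b := by
  rcases hp with rfl | rfl <;> rcases hq with rfl | rfl
  exacts [absurd rfl hpq, ⟨h, hpq⟩, ⟨h.symm, hpq.symm⟩, absurd rfl hpq]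

namespace TangleDiagram

variable {T : TangleDiagram} {s t : T.State} {c : Fin T.numCrossings}

/-- Changing the smoothing at `c` does not affect which half-edges lie on components through `c`. -/
theorem exists_comp_eq_of_agree (hst : ∀ d, d ≠ c → t d = s d) {h : T.Half} {i : Fin 4}
    (hc : comp s (Sum.inl (c, i)) = comp s h) : ∃ k, comp t (Sum.inl (c, k)) = comp t h := by
  refine comp_induction' (P := fun h => ∃ k, comp t (Sum.inl (c, k)) = comp t h) ?_ ?_ hc ⟨i, rfl⟩
  · rintro h ⟨k, hk⟩
    exact ⟨k, by rw [hk, comp_edge]⟩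
  · rintro d j ⟨k, hk⟩
    by_cases hd : d = c
    · subst hd
      exact ⟨_, rfl⟩
    · exact ⟨k, by rw [hk, ← hst d hd, comp_partner]⟩

/-- Changing the smoothing at `c` does not affect the components that do not meet `c`. -/
theorem comp_eq_comp_of_agree (hst : ∀ d, d ≠ c → t d = s d) {h g : T.Half}
    (hc : comp s h = comp s g) (hne : ∀ i, comp s h ≠ comp s (Sum.inl (c, i))) :
    comp t h = comp t g := by
  have : (∀ i, comp s g ≠ comp s (Sum.inl (c, i))) ∧ comp t h = comp t g := by
    refine comp_induction' (P := fun g => (∀ i, comp s g ≠ comp s (Sum.inl (c, i))) ∧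
      comp t h = comp t g) ?_ ?_ hc ⟨hne, rfl⟩
    · rintro k ⟨h1, h2⟩
      exact ⟨by rwa [comp_edge], by rw [h2, comp_edge]⟩
    · rintro d j ⟨h1, h2⟩
      refine ⟨by rwa [comp_partner], ?_⟩
      have hd : d ≠ c := fun hd => h1 j (by rw [hd])
      rw [h2, ← hst d hd, comp_partner]
  exact this.2

theorem comp_slot_of_eq_false (hc : s c = false) (i : Fin 4) :
    comp s (Sum.inl (c, i)) = comp s (Sum.inl (c, 0)) ∨
      comp s (Sum.inl (c, i)) = comp s (Sum.inl (c, 2)) := by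
  have h0 := comp_partner s c 0
  have h2 := comp_partner s c 2
  rw [hc] at h0 h2
  fin_cases i
  exacts [Or.inl rfl, Or.inl h0, Or.inr rfl, Or.inr h2]

theorem comp_slot_of_eq_true (hc : s c = true) (i : Fin 4) :
    comp s (Sum.inl (c, i)) = comp s (Sum.inl (c, 0)) ∨
      comp s (Sum.inl (c, i)) = comp s (Sum.inl (c, 1)) := by
  have h0 := comp_partner s c 0
  have h1 := comp_partner s c 1
  rw [hc] at h0 h1
  fin_cases i
  exacts [Or.inl rfl, Or.inr rfl, Or.inr h1, Or.inl h0]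

end TangleDiagram

namespace ArcAddition

open TangleDiagram

variable {T T' : TangleDiagram} {A : ArcAddition T T'}

/-- The saddle at the crossing on the added arc goes from two arcs to two arcs. -/
theorem saddleCoeff_crossing {s t : T.State} {s' t' : T'.State} (hs : A.Over s s')
    (ht : A.Over t t') (htr : t' A.crossing = true)
    (l : Labelling s') (m : Labelling t') : saddleCoeff A.crossing l m = 0 := by
  have opp : ∀ u' : T'.State, comp u' (Sum.inr A.startPt) ≠ comp u' (Sum.inr A.endPt) →
      comp u' (Sum.inl (A.crossing, 0)) ≠ comp u' (Sum.inl (A.crossing, 2)) := by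
    intro u' hne
    have h0 := Over.comp_slot (A := A) u'
    have h2 := Over.comp_slot_add_two (A := A) u'
    have h13 := Over.comp_slot_add_one_or_three (A := A) u'
    generalize A.slot = k at *
    fin_cases k <;> simp_all <;> grind
  have h1 := opp s' hs.comp_start_ne_end
  have h2 := opp t' ht.comp_start_ne_end
  -- The 1-smoothing joins slots 1 and 2, so slots 0 and 1 are on different parts after the saddle,
  -- as slots 0 and 2 are before it.
  have h3 := comp_partner t' A.crossing 1
  rw [htr] at h3
  change comp t' (Sum.inl (A.crossing, 2)) = _ at h3
  rw [h3] at h2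
  simp [saddleCoeff, h1, h2]

/-- `proj` identifies only the two parts of the cut arc. It can thus affect the choice between
product and coproduct only if the two strands at `c` lie on different parts. In that case neither
the saddle in `T` nor the one in `T'` is a merge or a split, and both coefficients are zero. -/
theorem saddleCoeff_pullback {s t : T.State} {s' t' : T'.State} (hs : A.Over s s')
    (ht : A.Over t t') {c : Fin T.numCrossings} (hst : ∀ d, d ≠ A.crossingMap c → t' d = s' d)
    (hsc : s c = false) (htc : t c = true) (l : Labelling s) (m : Labelling t) :
    saddleCoeff (A.crossingMap c) (hs.pullback l) (ht.pullback m) = saddleCoeff c l m := by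
  classical
  have hsc' : s' (A.crossingMap c) = false := (hs c).trans hsc
  have htc' : t' (A.crossingMap c) = true := (ht c).trans htc
  have pa : ∀ i, hs.proj (comp s' (Sum.inl (A.crossingMap c, i))) = comp s (Sum.inl (c, i)) :=
    fun i => hs.proj_comp_halfMap (Sum.inl (c, i))
  have pb : ∀ i, ht.proj (comp t' (Sum.inl (A.crossingMap c, i))) = comp t (Sum.inl (c, i)) :=
    fun i => ht.proj_comp_halfMap (Sum.inl (c, i))
  have ls : ∀ x, (hs.pullback l).1 x = l.1 (hs.proj x) := fun _ => rfl
  have lt : ∀ x, (ht.pullback m).1 x = m.1 (ht.proj x) := fun _ => rfl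
  have arc_s : l.1 (comp s A.cut) = TangleGen.w := (l.2 _).mpr (A.isArc_comp_cut s)
  have arc_t : m.1 (comp t A.cut) = TangleGen.w := (m.2 _).mpr (A.isArc_comp_cut t)
  have ps : hs.proj (comp s' (Sum.inr A.startPt)) = comp s A.cut := by
    rw [hs.proj_comp, proj_startPt]
  have pe : hs.proj (comp s' (Sum.inr A.endPt)) = comp s A.cut := by
    rw [hs.proj_comp, proj_endPt]
  have qs : ht.proj (comp t' (Sum.inr A.startPt)) = comp t A.cut := by
    rw [ht.proj_comp, proj_startPt]
  have qe : ht.proj (comp t' (Sum.inr A.endPt)) = comp t A.cut := by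
    rw [ht.proj_comp, proj_endPt]
  have a02 := comp_slot_of_eq_false hsc'
  have b01 := comp_slot_of_eq_true htc'
  have tr : ∀ (h : T'.Half) i, comp s' (Sum.inl (A.crossingMap c, i)) = comp s' h →
      comp t' h = comp t' (Sum.inl (A.crossingMap c, 0)) ∨
        comp t' h = comp t' (Sum.inl (A.crossingMap c, 1)) := by
    intro h i hi
    obtain ⟨k, hk⟩ := exists_comp_eq_of_agree hst hi
    exact hk ▸ b01 k
  have tr' : ∀ (h : T'.Half) i, comp t' (Sum.inl (A.crossingMap c, i)) = comp t' h →
      comp s' h = comp s' (Sum.inl (A.crossingMap c, 0)) ∨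
        comp s' h = comp s' (Sum.inl (A.crossingMap c, 2)) := by
    intro h i hi
    obtain ⟨k, hk⟩ := exists_comp_eq_of_agree (fun d hd => (hst d hd).symm) hi
    exact hk ▸ a02 k
  have ns := hs.comp_start_ne_end
  have nt := ht.comp_start_ne_end
  -- the two strands at `c` lie on the two parts of the added arc, before or after the saddle
  have mis : comp s (Sum.inl (c, 0)) = comp s (Sum.inl (c, 2)) →
      comp s' (Sum.inl (A.crossingMap c, 0)) ≠ comp s' (Sum.inl (A.crossingMap c, 2)) →
      comp t (Sum.inl (c, 0)) = comp t (Sum.inl (c, 1)) ∧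
      comp t' (Sum.inl (A.crossingMap c, 0)) ≠ comp t' (Sum.inl (A.crossingMap c, 1)) := by
    intro e ne
    have hcut : comp s (Sum.inl (c, 0)) = comp s A.cut := by
      by_contra hn
      exact ne (hs.proj_injOn (by rw [pa, pa, e]) (by rwa [pa]))
    have h0 := hs.eq_start_or_end _ ((pa 0).trans hcut)
    have h2 := hs.eq_start_or_end _ ((pa 2).trans (e ▸ hcut))
    rw [← pb, ← pb]
    -- The strands at `c` lie on the parts of `startPt` and `endPt`. Both parts still meet `c` after
    -- the saddle and are still different, so they are the components of slots 0 and 1.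
    rcases h0 with h0 | h0 <;> rcases h2 with h2 | h2
    · exact absurd (h0.trans h2.symm) ne
    · exact eq_and_ne_of_pair ht.proj nt (qs.trans qe.symm) (tr _ _ h0) (tr _ _ h2)
    · exact eq_and_ne_of_pair ht.proj nt (qs.trans qe.symm) (tr _ _ h2) (tr _ _ h0)
    · exact absurd (h0.trans h2.symm) ne
  have mis' : comp t (Sum.inl (c, 0)) = comp t (Sum.inl (c, 1)) →
      comp t' (Sum.inl (A.crossingMap c, 0)) ≠ comp t' (Sum.inl (A.crossingMap c, 1)) →
      comp s (Sum.inl (c, 0)) = comp s (Sum.inl (c, 2)) ∧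
      comp s' (Sum.inl (A.crossingMap c, 0)) ≠ comp s' (Sum.inl (A.crossingMap c, 2)) := by
    intro e ne
    have hcut : comp t (Sum.inl (c, 0)) = comp t A.cut := by
      by_contra hn
      exact ne (ht.proj_injOn (by rw [pb, pb, e]) (by rwa [pb]))
    have h0 := ht.eq_start_or_end _ ((pb 0).trans hcut)
    have h2 := ht.eq_start_or_end _ ((pb 1).trans (e ▸ hcut))
    rw [← pa, ← pa]
    rcases h0 with h0 | h0 <;> rcases h2 with h2 | h2
    · exact absurd (h0.trans h2.symm) ne
    · exact eq_and_ne_of_pair hs.proj ns (ps.trans pe.symm) (tr' _ _ h0) (tr' _ _ h2)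
    · exact eq_and_ne_of_pair hs.proj ns (ps.trans pe.symm) (tr' _ _ h2) (tr' _ _ h0)
    · exact absurd (h0.trans h2.symm) ne
  have up : comp s' (Sum.inl (A.crossingMap c, 0)) = comp s' (Sum.inl (A.crossingMap c, 2)) →
      comp s (Sum.inl (c, 0)) = comp s (Sum.inl (c, 2)) := fun h => by rw [← pa, ← pa, h]
  have up' : comp t' (Sum.inl (A.crossingMap c, 0)) = comp t' (Sum.inl (A.crossingMap c, 1)) →
      comp t (Sum.inl (c, 0)) = comp t (Sum.inl (c, 1)) := fun h => by rw [← pb, ← pb, h]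
  simp only [saddleCoeff]
  refine if_congr (and_congr ⟨fun H h h1 h2 => ?_, fun H h h1 h2 => ?_⟩ ⟨fun H k => ?_, fun H k => ?_⟩)
    ?_ rfl
  · have := H (A.halfMap h) (fun e => h1 ?_) (fun e => h2 ?_)
    · rwa [ls, lt, hs.proj_comp_halfMap, ht.proj_comp_halfMap] at this
    · rw [← pa, ← e, hs.proj_comp_halfMap]
    · rw [← pa, ← e, hs.proj_comp_halfMap]
  · rw [ls, lt]
    -- The cut arc of `T_s` may meet `c` while this part of it does not, so `H` need not apply. The
    -- part persists through the saddle, and its label is `w` before and after.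
    by_cases hcut : hs.proj (comp s' h) = comp s A.cut
    · have hn : ∀ i, comp s' h ≠ comp s' (Sum.inl (A.crossingMap c, i)) := by
        intro i hi
        rcases a02 i with h3 | h3
        exacts [h1 (hi.trans h3), h2 (hi.trans h3)]
      rcases hs.eq_start_or_end _ hcut with h3 | h3
      · rw [comp_eq_comp_of_agree hst h3 hn, h3, ps, qs, arc_s, arc_t]
      · rw [comp_eq_comp_of_agree hst h3 hn, h3, pe, qe, arc_s, arc_t]
    · rw [hs.proj_comp, ht.proj_comp]
      refine H _ (fun e => h1 ?_) (fun e => h2 ?_)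
      · exact hs.proj_injOn (by rw [pa, hs.proj_comp, e]) hcut
      · exact hs.proj_injOn (by rw [pa, hs.proj_comp, e]) hcut
  · exact H (k.cast A.numLoops_eq.symm)
  · exact H (k.cast A.numLoops_eq)
  · rw [ls, ls, lt, lt, pa, pa, pb, pb]
    by_cases e : comp s (Sum.inl (c, 0)) = comp s (Sum.inl (c, 2)) ∧
      comp s' (Sum.inl (A.crossingMap c, 0)) ≠ comp s' (Sum.inl (A.crossingMap c, 2))
    · have e' := mis e.1 e.2
      rw [if_neg fun h => e'.2 h.2, if_neg fun h => e.2 h.1, if_neg fun h => h.1 e.1,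
        if_neg fun h => h.2 e'.1]
    · have e' : ¬ (comp t (Sum.inl (c, 0)) = comp t (Sum.inl (c, 1)) ∧
          comp t' (Sum.inl (A.crossingMap c, 0)) ≠ comp t' (Sum.inl (A.crossingMap c, 1))) :=
        fun h => e (mis' h.1 h.2)
      have is : comp s' (Sum.inl (A.crossingMap c, 0)) = comp s' (Sum.inl (A.crossingMap c, 2)) ↔
          comp s (Sum.inl (c, 0)) = comp s (Sum.inl (c, 2)) :=
        ⟨up, fun h => by_contra fun h' => e ⟨h, h'⟩⟩
      have it : comp t' (Sum.inl (A.crossingMap c, 0)) = comp t' (Sum.inl (A.crossingMap c, 1)) ↔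
          comp t (Sum.inl (c, 0)) = comp t (Sum.inl (c, 1)) :=
        ⟨up', fun h => by_contra fun h' => e' ⟨h, h'⟩⟩
      simp only [ne_eq, is, it]

end ArcAddition

/-! ### Degree shifts, signs and the differential -/

namespace ArcAddition

open TangleDiagram

variable {T T' : TangleDiagram} (A : ArcAddition T T')

theorem univ_eq_insert_crossing :
    (Finset.univ : Finset (Fin T'.numCrossings)) =
      insert A.crossing (Finset.univ.map A.crossingMap) := by
  ext c
  rcases A.crossing_cases c with rfl | ⟨d, rfl⟩ <;> simp

theorem crossing_notMem_map : A.crossing ∉ Finset.univ.map A.crossingMap := by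
  simpa using A.crossingMap_ne

theorem sum_crossings {M : Type*} [AddCommMonoid M] (f : Fin T'.numCrossings → M) :
    ∑ c, f c = f A.crossing + ∑ d, f (A.crossingMap d) := by
  rw [A.univ_eq_insert_crossing, Finset.sum_insert A.crossing_notMem_map, Finset.sum_map]

theorem prod_crossings {M : Type*} [CommMonoid M] (f : Fin T'.numCrossings → M) :
    ∏ c, f c = f A.crossing * ∏ d, f (A.crossingMap d) := by
  rw [A.univ_eq_insert_crossing, Finset.prod_insert A.crossing_notMem_map, Finset.prod_map]

/-- The state of `T'` given by a state of `T` and the smoothing `b` of the new crossing. -/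
noncomputable def extendState (b : Bool) (s : T.State) : T'.State :=
  extend A.crossingMap s fun _ => b

theorem extendState_over (b : Bool) (s : T.State) : A.Over s (A.extendState b s) :=
  fun c => A.crossingMap.injective.extend_apply _ _ c

theorem extendState_crossing (b : Bool) (s : T.State) : A.extendState b s A.crossing = b :=
  extend_apply' _ _ _ fun ⟨c, hc⟩ => A.crossingMap_ne c hc

theorem eq_extendState (s' : T'.State) :
    s' = A.extendState (s' A.crossing) (s' ∘ A.crossingMap) := by
  ext c
  rcases A.crossing_cases c with rfl | ⟨d, rfl⟩
  · rw [extendState_crossing]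
  · rw [A.extendState_over]; rfl

theorem extendState_eq_update (b : Bool) (s t : T.State) (c : Fin T.numCrossings) :
    A.extendState b t = update (A.extendState b s) (A.crossingMap c) true ↔
      t = update s c true := by
  constructor
  · intro h
    ext d
    have := congrFun h (A.crossingMap d)
    rw [A.extendState_over] at this
    rw [this]
    by_cases hd : d = c
    · rw [hd, update_self, update_self]
    · rw [update_of_ne hd, update_of_ne (fun h => hd (A.crossingMap.injective h)),
        A.extendState_over]
  · rintro rfl
    ext d
    rcases A.crossing_cases d with rfl | ⟨d, rfl⟩
    · rw [update_of_ne (A.crossingMap_ne c).symm, extendState_crossing, extendState_crossing]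
    · rw [A.extendState_over]
      by_cases hd : d = c
      · rw [hd, update_self, update_self]
      · rw [update_of_ne hd, update_of_ne (fun h => hd (A.crossingMap.injective h)),
          A.extendState_over]

theorem height_extendState (b : Bool) (s : T.State) :
    height (A.extendState b s) = height s + if b = true then 1 else 0 := by
  simp only [height, Finset.card_filter]
  rw [A.sum_crossings, A.extendState_crossing, add_comm]
  simp only [A.extendState_over b s _]

theorem nPlus_eq : T'.nPlus = T.nPlus + if T'.positive A.crossing = true then 1 else 0 := by
  simp only [nPlus, Finset.card_filter]
  rw [A.sum_crossings, add_comm]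
  simp only [A.positive_crossingMap]

theorem nMinus_eq : T'.nMinus = T.nMinus + if T'.positive A.crossing = true then 0 else 1 := by
  simp only [nMinus, Finset.card_filter]
  rw [A.sum_crossings, add_comm]
  simp only [A.positive_crossingMap]
  cases T'.positive A.crossing <;> rfl

/-- The difference of the homological degrees in `T'` and in `T`. -/
def hshift (b : Bool) : ℤ :=
  (if b = true then 1 else 0) - if T'.positive A.crossing = true then 0 else 1

/-- The difference of the quantum degrees in `T'` and in `T`. -/
def qshift (b : Bool) : ℤ := A.hshift b + if T'.positive A.crossing = true then 0 else -2

/-- The basis vector of the complex of `T'` given by a basis vector of the complex of `T` and a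
smoothing of the new crossing. -/
noncomputable def lift (b : Bool) (S : T.Enhanced) : T'.Enhanced :=
  ⟨A.extendState b S.1, (A.extendState_over b S.1).pullback S.2⟩

theorem hdeg_lift (b : Bool) (S : T.Enhanced) : hdeg (A.lift b S) = hdeg S + A.hshift b := by
  simp only [hdeg, lift, hshift]
  rw [height_extendState, nMinus_eq A]
  push_cast
  ring

/-- Besides the homological shift, the writhe changes by 1 or -1 and the additional arc contributes
-1, which makes 0 or -2. -/
theorem qdeg_lift (b : Bool) (S : T.Enhanced) : qdeg (A.lift b S) = qdeg S + A.qshift b := by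
  have hsum : ∑ x, ((A.lift b S).2.1 x).deg = ∑ x, (S.2.1 x).deg - 1 :=
    (A.extendState_over b S.1).sum_deg_pullback S.2
  simp only [qdeg, qshift]
  rw [hsum, hdeg_lift, nMinus_eq A, nPlus_eq A]
  split_ifs <;> push_cast <;> ring

theorem lift_injective (b : Bool) : Injective (A.lift b) := by
  rintro ⟨s, l⟩ ⟨t, m⟩ h
  have hst : s = t := by
    have h1 : A.extendState b s = A.extendState b t := congrArg Sigma.fst h
    ext c
    rw [← A.extendState_over b s, h1, A.extendState_over]
  subst hst
  have h2 : (A.extendState_over b s).pullback l = (A.extendState_over b s).pullback m :=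
    eq_of_heq (Sigma.mk.inj h).2
  rw [(A.extendState_over b s).pullback_bijective.1 h2]

theorem lift_fst_crossing (b : Bool) (S : T.Enhanced) : (A.lift b S).1 A.crossing = b :=
  A.extendState_crossing b S.1

theorem exists_lift (S' : T'.Enhanced) : ∃ b S, A.lift b S = S' := by
  obtain ⟨s', l'⟩ := S'
  obtain ⟨b, s, rfl⟩ : ∃ b s, s' = A.extendState b s := ⟨_, _, A.eq_extendState s'⟩
  obtain ⟨l, rfl⟩ := (A.extendState_over b s).pullback_bijective.2 l'
  exact ⟨b, ⟨s, l⟩, rfl⟩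

/-- The sign change that relates the signs of the cubes of `T` and of `T'`. -/
noncomputable def sgn (b : Bool) (s : T.State) : ℤ :=
  (∏ i ∈ Finset.univ.filter (s · = true), ∏ j ∈ Finset.univ.filter (s · = true),
    if j < i ∧ A.crossingMap i < A.crossingMap j then -1 else 1) *
  ∏ i ∈ Finset.univ.filter (s · = true), if b = true ∧ A.crossing < A.crossingMap i then -1 else 1

theorem sgn_mul_self (b : Bool) (s : T.State) : A.sgn b s * A.sgn b s = 1 := by
  rw [sgn, mul_mul_mul_comm]
  simp only [← Finset.prod_mul_distrib]
  refine Finset.prod_eq_one fun i _ => ?_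
  rw [Finset.prod_eq_one fun j _ => by split_ifs <;> rfl]
  split_ifs <;> rfl

theorem edgeSign_eq_prod (s : T.State) (c : Fin T.numCrossings) :
    edgeSign s c = ∏ j ∈ Finset.univ.filter (s · = true), if j < c then -1 else 1 := by
  rw [edgeSign, ← Finset.prod_const, ← Finset.prod_filter, Finset.filter_filter]
  simp only [and_comm]

theorem edgeSign_extendState (b : Bool) (s : T.State) (c : Fin T.numCrossings) :
    edgeSign (A.extendState b s) (A.crossingMap c) =
      (if b = true ∧ A.crossing < A.crossingMap c then -1 else 1) *
        ∏ j ∈ Finset.univ.filter (s · = true),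
          if A.crossingMap j < A.crossingMap c then -1 else 1 := by
  rw [edgeSign_eq_prod, Finset.prod_filter, A.prod_crossings, A.extendState_crossing,
    Finset.prod_filter]
  simp only [A.extendState_over b s _]
  rw [ite_and]

/-- The coboundary of `sgn` is the ratio of the two edge signs. Adding `c` to the 1-smoothed
crossings multiplies `sgn` by the sign of the inversions of the renumbering that involve `c`, and by
the sign for the new crossing. -/
theorem sgn_update (b : Bool) (s : T.State) (c : Fin T.numCrossings) (hc : s c = false) :
    A.sgn b (update s c true) * edgeSign s c =
      edgeSign (A.extendState b s) (A.crossingMap c) * A.sgn b s := by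
  have hF : Finset.univ.filter (update s c true · = true) =
      insert c (Finset.univ.filter (s · = true)) := by
    ext d
    by_cases hd : d = c
    · simp [hd]
    · simp [hd]
  have hn : c ∉ Finset.univ.filter (s · = true) := by simp [hc]
  rw [edgeSign_extendState, edgeSign_eq_prod, sgn, sgn, hF]
  generalize Finset.univ.filter (s · = true) = F at *
  simp only [Finset.prod_insert hn, Finset.prod_mul_distrib, lt_irrefl, false_and, if_false,
    one_mul]
  -- Whether `j` precedes `c` is changed by the renumbering exactly when the pair is inverted; the
  -- two products count the inversions with `c < j` and with `j < c`.
  have key : (∏ j ∈ F, if A.crossingMap j < A.crossingMap c then (-1 : ℤ) else 1) =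
      ((∏ j ∈ F, if j < c ∧ A.crossingMap c < A.crossingMap j then -1 else 1) *
        ∏ j ∈ F, if c < j ∧ A.crossingMap j < A.crossingMap c then -1 else 1) *
      ∏ j ∈ F, if j < c then -1 else 1 := by
    rw [← Finset.prod_mul_distrib, ← Finset.prod_mul_distrib]
    refine Finset.prod_congr rfl fun j hj => ?_
    have hjc : j ≠ c := fun h => hn (h ▸ hj)
    have hjc' : A.crossingMap j ≠ A.crossingMap c := fun h => hjc (A.crossingMap.injective h)
    rcases lt_or_gt_of_ne hjc with h1 | h1 <;> rcases lt_or_gt_of_ne hjc' with h2 | h2 <;>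
      simp [h1, h2, h1.not_gt, h2.not_gt]
  rw [key]
  ring

theorem diffCoeff_lift (b : Bool) (S R : T.Enhanced) :
    diffCoeff (A.lift b S) (A.lift b R) = A.sgn b S.1 * A.sgn b R.1 * diffCoeff S R := by
  rw [diffCoeff, A.sum_crossings, if_neg, zero_add, diffCoeff, Finset.mul_sum]
  · refine Finset.sum_congr rfl fun c _ => ?_
    have hiff : (A.lift b S).1 (A.crossingMap c) = false ∧
        (A.lift b R).1 = update (A.lift b S).1 (A.crossingMap c) true ↔
        S.1 c = false ∧ R.1 = update S.1 c true :=
      and_congr (by rw [← A.extendState_over b S.1 c]; rfl) (A.extendState_eq_update b S.1 R.1 c)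
    rw [if_congr hiff rfl rfl]
    split_ifs with h
    · obtain ⟨h1, h2⟩ := h
      have hsaddle := saddleCoeff_pullback (A.extendState_over b S.1) (A.extendState_over b R.1)
        (c := c) (fun d hd => by
          rw [(A.extendState_eq_update b S.1 R.1 c).mpr h2, update_of_ne hd]) h1
        (by rw [h2, update_self]) S.2 R.2
      change edgeSign (A.extendState b S.1) (A.crossingMap c) * saddleCoeff (A.crossingMap c)
        ((A.extendState_over b S.1).pullback S.2) ((A.extendState_over b R.1).pullback R.2) = _
      rw [hsaddle, ← mul_assoc]
      congr 1
      have h3 := A.sgn_update b S.1 c h1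
      rw [← h2] at h3
      calc _ = edgeSign (A.extendState b S.1) (A.crossingMap c) * (A.sgn b S.1 * A.sgn b S.1) := by
            rw [sgn_mul_self, mul_one]
        _ = A.sgn b S.1 * (edgeSign (A.extendState b S.1) (A.crossingMap c) * A.sgn b S.1) := by
            ring
        _ = _ := by rw [← h3]; ring
    · rw [mul_zero]
  · rintro ⟨h1, h2⟩
    have := congrFun h2 A.crossing
    rw [update_self, lift_fst_crossing] at this
    rw [lift_fst_crossing, this] at h1
    exact Bool.noConfusion h1

/-- An edge of the cube between the two halves can only change the smoothing of the new crossing,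
where the saddle is zero. -/
theorem diffCoeff_lift_of_ne {b b' : Bool} (hb : b ≠ b') (S R : T.Enhanced) :
    diffCoeff (A.lift b S) (A.lift b' R) = 0 := by
  refine Finset.sum_eq_zero fun c _ => ?_
  split_ifs with h
  · obtain ⟨h1, h2⟩ := h
    have h3 := congrFun h2 A.crossing
    rw [lift_fst_crossing] at h3
    rcases A.crossing_cases c with rfl | ⟨d, rfl⟩
    · rw [update_self] at h3
      have := saddleCoeff_crossing (A.extendState_over b S.1) (A.extendState_over b' R.1)
        ((A.extendState_crossing b' R.1).trans h3) (A.lift b S).2 (A.lift b' R).2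
      exact mul_eq_zero_of_right _ this
    · rw [update_of_ne (A.crossingMap_ne d).symm, lift_fst_crossing] at h3
      exact absurd h3.symm hb
  · rfl

end ArcAddition

/-! ### Splitting of the homology -/

/-- The homology of a direct sum of two sequences is the direct sum of their homologies. -/
theorem nonempty_homology_equiv_prod {K : Type*} [Field K] {M₁ M₂ M₃ X₁ X₂ X₃ Y₁ Y₂ Y₃ : Type*}
    [AddCommGroup M₁] [AddCommGroup M₂] [AddCommGroup M₃] [AddCommGroup X₁] [AddCommGroup X₂]
    [AddCommGroup X₃] [AddCommGroup Y₁] [AddCommGroup Y₂] [AddCommGroup Y₃]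
    [Module K M₁] [Module K M₂] [Module K M₃] [Module K X₁] [Module K X₂]
    [Module K X₃] [Module K Y₁] [Module K Y₂] [Module K Y₃]
    {f : M₁ →ₗ[K] M₂} {g : M₂ →ₗ[K] M₃} {fX : X₁ →ₗ[K] X₂} {gX : X₂ →ₗ[K] X₃}
    {fY : Y₁ →ₗ[K] Y₂} {gY : Y₂ →ₗ[K] Y₃}
    (e₁ : M₁ ≃ₗ[K] X₁ × Y₁) (e₂ : M₂ ≃ₗ[K] X₂ × Y₂) (e₃ : M₃ ≃ₗ[K] X₃ × Y₃)
    (hf : ∀ v, e₂ (f v) = (fX (e₁ v).1, fY (e₁ v).2))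
    (hg : ∀ v, e₃ (g v) = (gX (e₂ v).1, gY (e₂ v).2)) :
    Nonempty ((LinearMap.ker g ⧸ (LinearMap.range f).comap (LinearMap.ker g).subtype) ≃ₗ[K]
      (LinearMap.ker gX ⧸ (LinearMap.range fX).comap (LinearMap.ker gX).subtype) ×
      (LinearMap.ker gY ⧸ (LinearMap.range fY).comap (LinearMap.ker gY).subtype)) := by
  have hker : ∀ v, g v = 0 ↔ gX (e₂ v).1 = 0 ∧ gY (e₂ v).2 = 0 := fun v => by
    rw [← e₃.map_eq_zero_iff, hg, Prod.mk_eq_zero]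
  have hrange : ∀ v, v ∈ LinearMap.range f ↔
      (e₂ v).1 ∈ LinearMap.range fX ∧ (e₂ v).2 ∈ LinearMap.range fY := by
    intro v
    constructor
    · rintro ⟨u, rfl⟩
      rw [hf]
      exact ⟨⟨_, rfl⟩, ⟨_, rfl⟩⟩
    · rintro ⟨⟨x, hx⟩, ⟨y, hy⟩⟩
      refine ⟨e₁.symm (x, y), e₂.injective ?_⟩
      rw [hf, e₁.apply_symm_apply]
      exact Prod.ext hx hy
  let pX : LinearMap.ker g →ₗ[K] LinearMap.ker gX :=
    LinearMap.codRestrict _ (LinearMap.fst K X₂ Y₂ ∘ₗ e₂.toLinearMap ∘ₗ (LinearMap.ker g).subtype)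
      fun v => ((hker v.1).mp v.2).1
  let pY : LinearMap.ker g →ₗ[K] LinearMap.ker gY :=
    LinearMap.codRestrict _ (LinearMap.snd K X₂ Y₂ ∘ₗ e₂.toLinearMap ∘ₗ (LinearMap.ker g).subtype)
      fun v => ((hker v.1).mp v.2).2
  -- By the first isomorphism theorem it suffices that this map from cycles to pairs of homology
  -- classes is onto with the boundaries as kernel. That consecutive maps compose to zero is never
  -- needed.
  let p := (Submodule.mkQ ((LinearMap.range fX).comap (LinearMap.ker gX).subtype) ∘ₗ pX).prod
    (Submodule.mkQ ((LinearMap.range fY).comap (LinearMap.ker gY).subtype) ∘ₗ pY)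
  have hp : LinearMap.ker p = (LinearMap.range f).comap (LinearMap.ker g).subtype := by
    ext v
    rw [LinearMap.mem_ker, Submodule.mem_comap, Submodule.subtype_apply, hrange]
    change (Submodule.Quotient.mk (pX v), Submodule.Quotient.mk (pY v)) = (0 : _ × _) ↔ _
    rw [Prod.mk_eq_zero, Submodule.Quotient.mk_eq_zero, Submodule.Quotient.mk_eq_zero]
    rfl
  have hsurj : Surjective p := by
    rintro ⟨x, y⟩
    obtain ⟨x, rfl⟩ := Submodule.Quotient.mk_surjective _ x
    obtain ⟨y, rfl⟩ := Submodule.Quotient.mk_surjective _ y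
    have hv : e₂ (e₂.symm (x.1, y.1)) = (x.1, y.1) := e₂.apply_symm_apply _
    refine ⟨⟨e₂.symm (x.1, y.1), (hker _).mpr (by rw [hv]; exact ⟨x.2, y.2⟩)⟩, ?_⟩
    refine Prod.ext (congrArg Submodule.Quotient.mk (Subtype.ext ?_))
      (congrArg Submodule.Quotient.mk (Subtype.ext ?_))
    · exact congrArg Prod.fst hv
    · exact congrArg Prod.snd hv
  exact ⟨(Submodule.quotEquivOfEq _ _ hp.symm).trans (p.quotKerEquivOfSurjective hsurj)⟩

namespace ArcAddition

open TangleDiagram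

variable {T T' : TangleDiagram} (A : ArcAddition T T')

/-- `lift` on the basis of a bidegree. -/
noncomputable def liftBasis (b : Bool) {k q i j : ℤ} (hk : i + A.hshift b = k)
    (hq : j + A.qshift b = q) (S : T.Basis i j) : T'.Basis k q :=
  ⟨A.lift b S.1, by rw [hdeg_lift, S.2.1, hk], by rw [qdeg_lift, S.2.2, hq]⟩

variable {k q i j i' j' : ℤ} (hk : i + A.hshift false = k) (hq : j + A.qshift false = q)
  (hk' : i' + A.hshift true = k) (hq' : j' + A.qshift true = q)

theorem liftBasis_bijective :
    Bijective (Sum.elim (A.liftBasis false hk hq) (A.liftBasis true hk' hq')) := by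
  constructor
  · have hne : ∀ S R, A.lift false S ≠ A.lift true R := fun S R h => by
      have := A.lift_fst_crossing false S
      rw [h, lift_fst_crossing] at this
      exact Bool.noConfusion this
    rintro (S | S) (R | R) h
    · exact congrArg _ (Subtype.ext (A.lift_injective _ (congrArg Subtype.val h)))
    · exact absurd (congrArg Subtype.val h) (hne _ _)
    · exact absurd (congrArg Subtype.val h).symm (hne _ _)
    · exact congrArg _ (Subtype.ext (A.lift_injective _ (congrArg Subtype.val h)))
  · rintro ⟨S', h1, h2⟩
    obtain ⟨b, S, rfl⟩ := A.exists_lift S'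
    rw [hdeg_lift] at h1
    rw [qdeg_lift] at h2
    cases b
    · exact ⟨Sum.inl ⟨S, by omega, by omega⟩, rfl⟩
    · exact ⟨Sum.inr ⟨S, by omega, by omega⟩, rfl⟩

variable (K : Type*) [Field K]

theorem sgn_cast_mul_self (b : Bool) (s : T.State) : (A.sgn b s : K) * (A.sgn b s : K) = 1 := by
  rw [← Int.cast_mul, sgn_mul_self, Int.cast_one]

/-- The coordinates of a chain of `T'` at the basis vectors that are lifted from `T`, with the sign
change that turns the differential of `T'` into that of `T`. -/
noncomputable def chainMap :
    (T'.Basis k q → K) →ₗ[K] (T.Basis i j → K) × (T.Basis i' j' → K) where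
  toFun v := (fun S => A.sgn false S.1.1 * v (A.liftBasis false hk hq S),
    fun S => A.sgn true S.1.1 * v (A.liftBasis true hk' hq' S))
  map_add' v w := by ext <;> simp [mul_add]
  map_smul' a v := by ext <;> simp [mul_left_comm]

/-- The chain space of `T'` in a bidegree is the direct sum of two chain spaces of `T`. -/
noncomputable def chainEquiv :
    (T'.Basis k q → K) ≃ₗ[K] (T.Basis i j → K) × (T.Basis i' j' → K) :=
  LinearEquiv.ofBijective (A.chainMap hk hq hk' hq' K) (by
      have hb := A.liftBasis_bijective hk hq hk' hq'
      constructor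
      · intro v w h
        ext S'
        obtain ⟨S | S, rfl⟩ := hb.2 S'
        · exact mul_left_cancel₀ (left_ne_zero_of_mul_eq_one (A.sgn_cast_mul_self K false S.1.1))
            (congrFun (congrArg Prod.fst h) S)
        · exact mul_left_cancel₀ (left_ne_zero_of_mul_eq_one (A.sgn_cast_mul_self K true S.1.1))
            (congrFun (congrArg Prod.snd h) S)
      · rintro ⟨v, w⟩
        let E := Equiv.ofBijective _ hb
        let u : _ → K := Sum.elim (fun S => A.sgn false S.1.1 * v S) fun S => A.sgn true S.1.1 * w S
        refine ⟨u ∘ E.symm, Prod.ext ?_ ?_⟩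
        · ext S
          have : E.symm (A.liftBasis false hk hq S) = Sum.inl S := E.symm_apply_apply (Sum.inl S)
          change _ * u (E.symm (A.liftBasis false hk hq S)) = v S
          rw [this]
          change _ * (_ * v S) = v S
          rw [← mul_assoc, sgn_cast_mul_self, one_mul]
        · ext S
          have : E.symm (A.liftBasis true hk' hq' S) = Sum.inr S := E.symm_apply_apply (Sum.inr S)
          change _ * u (E.symm (A.liftBasis true hk' hq' S)) = w S
          rw [this]
          change _ * (_ * w S) = w S
          rw [← mul_assoc, sgn_cast_mul_self, one_mul])

theorem diff_apply (T : TangleDiagram) (k k' q : ℤ) (v : T.Basis k q → K) (R : T.Basis k' q) :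
    T.diff K k k' q v R = ∑ S, (diffCoeff S.1 R.1 : K) * v S := rfl

/-- The differential is block diagonal by `diffCoeff_lift_of_ne`, and on each block the conjugation
by `sgn` cancels the signs of `diffCoeff_lift`. -/
theorem chainEquiv_diff {l m m' : ℤ} (hl : m + A.hshift false = l) (hl' : m' + A.hshift true = l)
    (v : T'.Basis k q → K) :
    A.chainEquiv hl hq hl' hq' K (T'.diff K k l q v) =
      (T.diff K i m j (A.chainEquiv hk hq hk' hq' K v).1,
        T.diff K i' m' j' (A.chainEquiv hk hq hk' hq' K v).2) := by
  have hsum : ∀ R, T'.diff K k l q v R =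
      ∑ S, (diffCoeff (A.lift false S.1) R.1 : K) * v (A.liftBasis false hk hq S) +
      ∑ S, (diffCoeff (A.lift true S.1) R.1 : K) * v (A.liftBasis true hk' hq' S) := by
    intro R
    rw [diff_apply, ← (A.liftBasis_bijective hk hq hk' hq').sum_comp, Fintype.sum_sum_type]
    rfl
  have hterm : ∀ (b : Bool) (S R : T.Enhanced) (a : K),
      (A.sgn b R.1 : K) * ((diffCoeff (A.lift b S) (A.lift b R) : K) * a) =
        (diffCoeff S R : K) * (A.sgn b S.1 * a) := by
    intro b S R a
    rw [diffCoeff_lift]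
    push_cast
    calc _ = ((A.sgn b R.1 : K) * A.sgn b R.1) * ((diffCoeff S R : K) * (A.sgn b S.1 * a)) := by
          ring
      _ = _ := by rw [sgn_cast_mul_self, one_mul]
  refine Prod.ext (funext fun R => ?_) (funext fun R => ?_)
  · change (A.sgn false R.1.1 : K) * T'.diff K k l q v (A.liftBasis false hl hq R) = _
    have h0 : ∀ S : T.Basis i' j',
        diffCoeff (A.lift true S.1) (A.liftBasis false hl hq R).1 = 0 :=
      fun S => A.diffCoeff_lift_of_ne (by decide) S.1 R.1
    rw [hsum]
    simp only [h0, Int.cast_zero, zero_mul, Finset.sum_const_zero, add_zero]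
    rw [Finset.mul_sum]
    exact Finset.sum_congr rfl fun S _ => hterm false S.1 R.1 _
  · change (A.sgn true R.1.1 : K) * T'.diff K k l q v (A.liftBasis true hl' hq' R) = _
    have h0 : ∀ S : T.Basis i j,
        diffCoeff (A.lift false S.1) (A.liftBasis true hl' hq' R).1 = 0 :=
      fun S => A.diffCoeff_lift_of_ne (by decide) S.1 R.1
    rw [hsum]
    simp only [h0, Int.cast_zero, zero_mul, Finset.sum_const_zero, zero_add]
    rw [Finset.mul_sum]
    exact Finset.sum_congr rfl fun S _ => hterm true S.1 R.1 _

theorem nonempty_kh_equiv (hk : i + A.hshift false = k) (hq : j + A.qshift false = q)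
    (hk' : i' + A.hshift true = k) (hq' : j' + A.qshift true = q) :
    Nonempty (T'.Kh K k q ≃ₗ[K] T.Kh K i j × T.Kh K i' j') :=
  nonempty_homology_equiv_prod
    (A.chainEquiv (k := k - 1) (i := i - 1) (i' := i' - 1) (by omega) hq (by omega) hq' K)
    (A.chainEquiv hk hq hk' hq' K)
    (A.chainEquiv (k := k + 1) (i := i + 1) (i' := i' + 1) (by omega) hq (by omega) hq' K)
    (A.chainEquiv_diff _ _ _ _ K _ _) (A.chainEquiv_diff _ _ _ _ K _ _)

end ArcAddition

end

theorem theorem2p1 (K : Type*) [Field K] (T T' : TangleDiagram) (A : ArcAddition T T') :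
    (T'.positive A.crossing = true → ∀ k q : ℤ,
      Nonempty (T'.Kh K k q ≃ₗ[K] T.Kh K k q × T.Kh K (k - 1) (q - 1))) ∧
    (T'.positive A.crossing = false → ∀ k q : ℤ,
      Nonempty (T'.Kh K k q ≃ₗ[K] T.Kh K (k + 1) (q + 3) × T.Kh K k (q + 2))) := by
  constructor
  -- The shifts in homological and quantum degree are (0, 0) for the 0-smoothing and (1, 1) for the
  -- 1-smoothing.
  · intro h k q
    refine A.nonempty_kh_equiv K ?_ ?_ ?_ ?_ <;>
      simp only [ArcAddition.hshift, ArcAddition.qshift, h] <;> norm_num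
  -- Here the shifts are (-1, -3) and (0, -2).
  · intro h k q
    refine A.nonempty_kh_equiv K ?_ ?_ ?_ ?_ <;>
      simp only [ArcAddition.hshift, ArcAddition.qshift, h] <;> norm_num
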